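/- Let $\mathcal A=\{H_{s,t}=\{x_s=x_t\}: 1\le s<t\le n+1\}$ be the braid arrangement in $\mathbb R^{n+1}$, filtered by $\mathcal A_1\subset\dots\subset\mathcal A_n$ with $\mathcal A_m\setminus\mathcal A_{m-1}=\{H_{1,m+1},\dots,H_{m,m+1}\}$, and let $C_0=\{x_1<\dots<x_{n+1}\}$. **Tableaux.** A face $F$ (stratum of $\mathcal A$) of codimension $k$ is represented by a tableau with $n+1-k$ rows containing each of $1,\dots,n+1$ once: for $x\in F$, $x_a=x_b$ iff $a,b$ are in the same row, and $x_a<x_b$ iff the row of $a$ precedes that of $b$. Write $F\prec G$ iff $\overline G\subseteq\overline F$. For $1<j_1<\dots<j_k\le n+1$ and admissible row indices $i_1,\dots,i_k$, the critical $k$-tableau is $$((\cdots((T_1^{op}*_{i_1}j_1)*T_2)^{op}*_{i_2}j_2)*\cdots)^{op}*_{i_k}j_k)*T_{k+1},$$ where $T_h$ is the column with entries $j_{h-1}+1,\dots,j_h-1$ in natural order ($j_0=0$, $j_{k+1}=n+2$), $*$ is vertical attachment, $op$ reverses the order of rows, and $T*_ih$ attaches a box $h$ to row $i$ of $T$. Order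 critical $k$-tableaux lexicographically by $((j_1,i_1),\dots,(j_k,i_k))$, where $(j,i)<(j',i')$ iff $j<j'$, or $j=j'$ and $i>i'$. **Critical cells.** Fix an affine flag $V_0\subset\dots\subset V_n$, $\dim V_k=k$, spanned by an origin and $n$ successive axes, such that for every element $L$ of the intersection lattice, of codimension $k$, $V_k\cap L$ is a single point whose first $k$ coordinates are positive. Let $(\rho,\theta_1,\dots,\theta_{n-1})$ be the polar coordinates on $V_n$ (so $V_k=\{\theta_k=\dots=\theta_{n-1}=0\}$), compared lexicographically with $\theta_{n-1}$ first and $\rho$ last. A face of codimension $k$ that meets $V_k$ is called $k$-critical. Assume, as for the flags used for the braid arrangement, that the $k$-critical faces are exactly the faces represented by critical $k$-tableaux, and that the polar order of the points $p\cap V_k$, $p$ a $k$-critical face, is the order of critical tableaux. For a chamber $C$ and a $k$-critical face $p$ with $C\prec p$, the cell $[C\prec p]$ is critical if every face $G\neq p$ with $C\prec G\prec p$ precedes $p$ in the polar ordering, i.e. $\overline G$ contains a point with nonnegative coordinates and smaller polar coordinates than the point $p\cap V_k$. **The tuple $f_k([C\prec p])$.** For a hyperplane $H_{s,t}\supseteq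 p$ put $[H_{s,t}]_p=\{H_{a,t}: a<t,\ p\subseteq H_{a,t}\}$, ordered, as seen from $C$, by $H_{a,t}<H_{b,t}$ iff $x_a<x_b$ on $C$. Put $f_k([C\prec p])=(H_1,\dots,H_k)$, $H_j=H_{s'_j,t_j}$ with $s'_j<t_j$ and $t_1<\dots<t_k$, iff 1. $\bigcap_jH_j$ is the support of $p$; 2. if $k-j$ is odd, $H_j$ is the minimum of the hyperplanes in $[H_j]_p$ that separate $C$ from $C_0$; 3. if $k-j$ is even, $H_j$ is the maximum of the hyperplanes in $[H_j]_p$ that do not separate $C$ from $C_0$; 4. if $k\ge 1$, $H_k$ is a wall of $C$ and does not separate $C$ from $C_0$. **The relation $<_{[C\prec p]}$.** It is obtained from this tuple recursively: for $k=0$ it is empty; for $k\ge1$, reverse the relation obtained from the first $k-1$ hyperplanes, and insert $t_k$ immediately before $s'_k$ (so $t_k$ is below $s'_k$ and above exactly those elements that are below $s'_k$ in the reversed relation, and below those that are above $s'_k$). **Proposition.** For every critical $k$-cell $[C\prec p]$ there is exactly one tuple $f_k([C\prec p])$, and the relation $<_{[C\prec p]}$ satisfies: $t_j<_{[C\prec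 p]}s'_j$ if $k-j$ is even; $s'_j<_{[C\prec p]}t_j$ if $k-j$ is odd; no element lies strictly between $t_k$ and $s'_k$ when $k\ge1$. If $T_p$ is any tableau representing $p$, it has $n+1-k$ rows, and $<_{[C\prec p]}$ is a strict total order on the entries of each row of $T_p$. -/

import Mathlib

/-!
Faces and chambers of the braid arrangement in `ℝ^(n+1)`, generic polar systems, critical cells of
the Salvetti complex, critical tableaux, the correspondence `f_k`, and the order `<_{[C ≺ p]}`.
Coordinates, tableau entries and rows are numbered from `0`, so the index `m : Fin (n + 1)` plays
the role of `m + 1 ∈ {1, …, n + 1}`.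
-/

noncomputable section

namespace Braid

open Set

/-! ### The braid arrangement -/

/-- Points of the ambient space `ℝ^(n+1)`. -/
abbrev Pt (n : ℕ) : Type := Fin (n + 1) → ℝ

/-- Hyperplanes `H_{s,t}` are encoded by pairs `(s, t)`; `s < t` is required where it is used. -/
abbrev HPair (n : ℕ) : Type := Fin (n + 1) × Fin (n + 1)

/-- The hyperplane `H_{s,t} = {x_s = x_t}`. -/
def hyp {n : ℕ} (H : HPair n) : Set (Pt n) := {x | x H.1 = x H.2}

/-- The stratum (relatively open face) of the braid arrangement through `x`: all points on the
same side of, or on, each hyperplane as `x`. -/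
def faceOf {n : ℕ} (x : Pt n) : Set (Pt n) := {y | ∀ s t, y s < y t ↔ x s < x t}

/-- `F` is a face (stratum) of the braid arrangement. -/
def IsFace {n : ℕ} (F : Set (Pt n)) : Prop := ∃ x, F = faceOf x

/-- `C` is a chamber: a face lying on no hyperplane of the arrangement. -/
def IsChamber {n : ℕ} (C : Set (Pt n)) : Prop := ∃ x, Function.Injective x ∧ C = faceOf x

/-- Codimension of (the affine span of) a face. -/
def codim {n : ℕ} (F : Set (Pt n)) : ℕ := (n + 1) - Module.finrank ℝ (vectorSpan ℝ F)

/-- The order `F ≺ G` (in the weak sense) on faces: reverse inclusion of closures. -/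
def FaceLE {n : ℕ} (F G : Set (Pt n)) : Prop := closure G ⊆ closure F

/-- The base chamber `C₀ = {x_1 < x_2 < ⋯ < x_{n+1}}`. -/
def baseChamber (n : ℕ) : Set (Pt n) := {x | StrictMono x}

/-- `H` separates the chambers `C` and `D`, i.e. `(C | D)_H = -1`. -/
def Separates {n : ℕ} (H : HPair n) (C D : Set (Pt n)) : Prop :=
  ∀ x ∈ C, ∀ y ∈ D, (x H.1 - x H.2) * (y H.1 - y H.2) < 0

/-- `H` is a wall of the chamber `C`: it contains a face of codimension one in the closure
of `C`. -/
def IsWall {n : ℕ} (H : HPair n) (C : Set (Pt n)) : Prop :=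
  ∃ G : Set (Pt n), IsFace G ∧ codim G = 1 ∧ FaceLE C G ∧ G ⊆ hyp H

/-- The intersection of all hyperplanes of the arrangement containing `x`. Every element of the
intersection lattice is of this form. -/
def flatThrough {n : ℕ} (x : Pt n) : Submodule ℝ (Pt n) where
  carrier := {z | ∀ s t, x s = x t → z s = z t}
  zero_mem' := fun _ _ _ => rfl
  add_mem' := fun ha hb s t h => by simp [ha s t h, hb s t h]
  smul_mem' := fun c z hz s t h => by simp [hz s t h]

/-! ### Polar systems -/

/-- An origin and `n` axes. They give the flag of affine subspaces
`V_k = origin + span(axis_1, …, axis_k)` (`0 ≤ k ≤ n`), and polar coordinates on `V_n`. For a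
generic system `V_n` is a complement of the diagonal line, so that the braid arrangement induces
on `V_n` its essential version. -/
structure PolarSystem (n : ℕ) where
  origin : Pt n
  axis : Fin n → Pt n

/-- The point of `V_n` with affine coordinates `y`. -/
def PolarSystem.pt {n : ℕ} (S : PolarSystem n) (y : Fin n → ℝ) : Pt n :=
  S.origin + ∑ i, y i • S.axis i

/-- `y` are the coordinates of a point of `V_k`. -/
def InV {n : ℕ} (k : ℕ) (y : Fin n → ℝ) : Prop := ∀ i : Fin n, k ≤ i.1 → y i = 0

/-- The norm `√(y_m² + ⋯ + y_{n-1}²)` of the tail of `y`. -/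
def tailNorm {n : ℕ} (y : Fin n → ℝ) (m : ℕ) : ℝ :=
  Real.sqrt (∑ i : Fin n, if m ≤ i.1 then y i ^ 2 else 0)

/-- Polar coordinates `(ρ, θ_1, …, θ_{n-1})` of a point with nonnegative coordinates `y`:
entry `0` is `ρ = |y|`, and entry `m ≥ 1` is the angle `θ_m` with
`tan θ_m = |(y_m, …, y_{n-1})| / y_{m-1}`
(equal to `0` if `y_{m-1}, …, y_{n-1}` all vanish). Thus `V_k` is given by
`θ_k = ⋯ = θ_{n-1} = 0`, and increasing `θ_{k-1}` rotates `V_{k-1}` inside `V_k` around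
`V_{k-2}`. -/
def polar {n : ℕ} (y : Fin n → ℝ) (m : Fin n) : ℝ :=
  if m.1 = 0 then tailNorm y 0
  else Complex.arg ⟨y ⟨m.1 - 1, by omega⟩, tailNorm y m.1⟩

/-- Strict lexicographic order of polar coordinates, comparing `θ_{n-1}` first, `ρ` last. -/
def PolarLT {n : ℕ} (y y' : Fin n → ℝ) : Prop :=
  ∃ m : Fin n, (∀ l : Fin n, m < l → polar y l = polar y' l) ∧ polar y m < polar y' m

/-- The system is generic: for each element `L` of the intersection lattice, of codimension `k`,
the space `V_k` meets `L` in exactly one point, and the first `k` coordinates of this point are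
positive. This says that the flag is in general position (`dim (V_j ∩ L) = j - k` for `j ≥ k`, and
`V_j ∩ L = ∅` for `j < k`) and that the vertices, hence the bounded faces, of the arrangement
induced on each `V_k` lie in the open region `ρ > 0`, `0 < θ_i < π / 2`, `i < k`. -/
def PolarSystem.Generic {n : ℕ} (S : PolarSystem n) : Prop :=
  LinearIndependent ℝ S.axis ∧
  ∀ x : Pt n, ∃ y : Fin n → ℝ,
    (∀ i : Fin n, i.1 < (n + 1) - Module.finrank ℝ (flatThrough x) → 0 < y i) ∧
    ∀ y' : Fin n → ℝ,
      (InV ((n + 1) - Module.finrank ℝ (flatThrough x)) y' ∧ S.pt y' ∈ flatThrough x) ↔ y' = y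

/-- `y` are the coordinates of a point of `F ∩ V_k`. -/
def PolarSystem.MeetsAt {n : ℕ} (S : PolarSystem n) (k : ℕ) (F : Set (Pt n))
    (y : Fin n → ℝ) : Prop :=
  InV k y ∧ S.pt y ∈ F

/-- `F` is a `k`-critical face, `F ∈ 𝒫^k`: it has codimension `k` and meets `V_k`. -/
def PolarSystem.IsCriticalFace {n : ℕ} (S : PolarSystem n) (k : ℕ) (F : Set (Pt n)) : Prop :=
  IsFace F ∧ codim F = k ∧ ∃ y, S.MeetsAt k F y

/-- `[C ≺ F]` is a critical `k`-cell of the Salvetti complex: `F` has codimension `k` and meets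
`V_k`, and every face `G ≠ F` with `C ≺ G ≺ F` precedes `F` in the polar ordering.

Faces are ordered by the least point of their closures, in the lexicographic order of polar
coordinates. The least point of the closure of `F` is the point `F ∩ V_k`; it belongs to the
closure of every such `G`, and, lying in `F`, it is the label of `F` and of later faces only. Hence
`G` precedes `F` iff the closure of `G` has a point with smaller polar coordinates. -/
def PolarSystem.IsCriticalCell {n : ℕ} (S : PolarSystem n) (k : ℕ) (C F : Set (Pt n)) : Prop :=
  IsChamber C ∧ FaceLE C F ∧ S.IsCriticalFace k F ∧
  ∀ y, S.MeetsAt k F y → ∀ G, IsFace G → FaceLE C G → FaceLE G F → G ≠ F →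
    ∃ q : Fin n → ℝ, (∀ i, 0 ≤ q i) ∧ S.pt q ∈ closure G ∧ PolarLT q y

/-! ### Tableaux -/

/-- Tableaux, as lists of rows. -/
abbrev Tab (n : ℕ) : Type := List (List (Fin (n + 1)))

/-- Each of the `n + 1` integers is in exactly one box, and no row is empty. -/
def IsTableau {n : ℕ} (T : Tab n) : Prop :=
  T.flatten.Perm (List.finRange (n + 1)) ∧ ∀ r ∈ T, r ≠ []

/-- The (index of the) row of `T` which contains `s`. -/
def rowOf {n : ℕ} (T : Tab n) (s : Fin (n + 1)) : ℕ := T.findIdx (fun r => decide (s ∈ r))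

/-- `T` is a tableau representing the face `F`. -/
def Represents {n : ℕ} (T : Tab n) (F : Set (Pt n)) : Prop :=
  IsTableau T ∧ ∀ x : Pt n, x ∈ F ↔
    ∀ s t, (x s = x t ↔ rowOf T s = rowOf T t) ∧ (x s < x t ↔ rowOf T s < rowOf T t)

/-- The one-column tableau with entries `a, a + 1, …, b - 1`. -/
def column (n a b : ℕ) : Tab n :=
  ((List.finRange (n + 1)).filter (fun m => decide (a ≤ m.1 ∧ m.1 < b))).map (fun m => [m])

/-- `T *_i h`: attach a box with entry `h` to the `i`-th row of `T`. -/
def attach {n : ℕ} (T : Tab n) (i : ℕ) (h : Fin (n + 1)) : Tab n := T.modify i (fun r => r ++ [h])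

/-- One continues a tableau `R`, whose entries are those below `m`, along the list of pairs
`(j, i)`: attach vertically the column of the entries from `m` to `j - 1`, reverse the order of
the rows, and attach `j` to row `i`. After the last pair the column of the remaining entries is
attached vertically. -/
def critTabFrom {n : ℕ} : Tab n → ℕ → List (Fin (n + 1) × ℕ) → Tab n
  | R, m, [] => R ++ column n m (n + 1)
  | R, m, (j, i) :: L => critTabFrom (attach (R ++ column n m j.1).reverse i j) (j.1 + 1) L

/-- The data `1 < j_1 < ⋯ < j_k ≤ n + 1`, `i_1, …, i_k` of a critical `k`-tableau. The bound says
that the tableau to which the box `j_h` is attached has a row with index `i_h`. -/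
structure CritCode (n k : ℕ) where
  j : Fin k → Fin (n + 1)
  i : Fin k → ℕ
  strictMono : StrictMono j
  bound : ∀ h, i h + h.1 < (j h).1

/-- The critical tableau
`((⋯(((T_1^op *_{i_1} j_1) * T_2)^op *_{i_2} j_2) * T_3)^op ⋯)^op *_{i_k} j_k) * T_{k+1}`. -/
def CritCode.tab {n k : ℕ} (c : CritCode n k) : Tab n :=
  critTabFrom [] 0 (List.ofFn (fun h => (c.j h, c.i h)))

/-- The lexicographic order of the sequences `((j_1, i_1), …, (j_k, i_k))`, where
`(j, i) < (j', i')` iff `j < j'`, or `j = j'` and `i > i'`. -/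
def CritCode.Lt {n k : ℕ} (c c' : CritCode n k) : Prop :=
  ∃ h : Fin k, (∀ l : Fin k, l < h → c.j l = c'.j l ∧ c.i l = c'.i l) ∧
    (c.j h < c'.j h ∨ (c.j h = c'.j h ∧ c'.i h < c.i h))

/-- The choice of the polar system for the braid arrangement: it is generic, its `k`-critical
faces are those represented by the critical `k`-tableaux, and the polar ordering of the
`k`-critical faces is the lexicographic order of these tableaux. -/
structure PolarSystem.IsTableauSystem {n : ℕ} (S : PolarSystem n) : Prop where
  generic : S.Generic
  criticalFace_iff : ∀ (k : ℕ) (F : Set (Pt n)),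
    S.IsCriticalFace k F ↔ ∃ c : CritCode n k, Represents c.tab F
  polar_lt : ∀ (k : ℕ) (c c' : CritCode n k) (F F' : Set (Pt n)) (y y' : Fin n → ℝ),
    Represents c.tab F → Represents c'.tab F' → S.MeetsAt k F y → S.MeetsAt k F' y' →
    c.Lt c' → PolarLT y y'

/-! ### The correspondence `f_k` -/

/-- The class `[H_{s,t}]_p`: the hyperplanes containing `p` in the same difference
`𝒜_j ∖ 𝒜_{j-1} = {H_{1,j+1}, …, H_{j,j+1}}` of the supersolvable filtration as `H_{s,t}`. -/
def hypClass {n : ℕ} (p : Set (Pt n)) (H : HPair n) : Set (HPair n) :=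
  {H' | H'.1 < H'.2 ∧ H'.2 = H.2 ∧ p ⊆ hyp H'}

/-- `k`-tuples `(H_1, …, H_k)` in the basis `nbc_k`: the `H_j` belong to strictly increasing
differences of the filtration. -/
def IsNbc {n : ℕ} (k : ℕ) (H : Fin k → HPair n) : Prop :=
  (∀ j, (H j).1 < (H j).2) ∧ StrictMono (fun j => (H j).2)

/-- The linear order on `[H]_p` seen from the chamber `C`: `H_{s,t}` comes before `H_{s',t}` iff
`x_s < x_{s'}` on `C`. (Inside the chamber containing `C` of the arrangement of the lower
hyperplanes `H_{a,b} ⊇ p`, `b < t`, the hyperplanes in `[H]_p` do not cross; this is the order in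
which they are met when `x_t` increases.) -/
def HypBefore {n : ℕ} (C : Set (Pt n)) (H H' : HPair n) : Prop := ∀ x ∈ C, x H.1 < x H'.1

/-- The relation `f_k([C ≺ p]) = (H_1, …, H_k)`. The `j`-th hyperplane, `1 ≤ j ≤ k`, is
`H ⟨j - 1, _⟩`. -/
structure NablaRel {n k : ℕ} (C p : Set (Pt n)) (H : Fin k → HPair n) : Prop where
  nbc : IsNbc k H
  support : (⋂ j, hyp (H j)) = (affineSpan ℝ p : Set (Pt n))
  odd : ∀ j : Fin k, (-1 : ℤ) ^ (k - (j.1 + 1)) = -1 →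
    Separates (H j) C (baseChamber n) ∧
    ∀ H' ∈ hypClass p (H j), Separates H' C (baseChamber n) → H' ≠ H j → HypBefore C (H j) H'
  even : ∀ j : Fin k, (-1 : ℤ) ^ (k - (j.1 + 1)) = 1 →
    ¬ Separates (H j) C (baseChamber n) ∧
    ∀ H' ∈ hypClass p (H j), ¬ Separates H' C (baseChamber n) → H' ≠ H j → HypBefore C H' (H j)
  wall : ∀ j : Fin k, j.1 + 1 = k → IsWall (H j) C ∧ ¬ Separates (H j) C (baseChamber n)

/-! ### The order `<_{[C ≺ p]}` -/

/-- The order determined by a `k`-tuple `(H_{s_1,t_1}, …, H_{s_k,t_k})`, by recursion on `k`: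
reverse the order determined by the first `k - 1` hyperplanes, then insert the new element `t_k`
immediately before `s_k`. -/
def cellLT {n : ℕ} : (k : ℕ) → (Fin k → HPair n) → Fin (n + 1) → Fin (n + 1) → Prop
  | 0, _, _, _ => False
  | k + 1, H, a, b =>
    let s := (H (Fin.last k)).1
    let t := (H (Fin.last k)).2
    let r := cellLT k (Fin.init H)
    (a ≠ t ∧ b ≠ t ∧ r b a) ∨ (a = t ∧ (b = s ∨ r b s)) ∨ (b = t ∧ r s a)

end Braid

end

/-!
Let `p` be the face of `x` and `C` the chamber of `c`, and call the sets of indices with equal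
`x`-coordinate blocks. The codimension of `p` is the number `k` of indices that are not least in
their block (`nonMin x`), so in a tuple `(H_{s_j, t_j})` whose intersection is the support of `p`
the `t_j` are exactly these indices in increasing order. Each `s_j` is then forced: among the smaller
elements of the block of `t_j` it is the last one before `t_j` in the order of `C` if `k - j` is even,
and the first one after `t_j` if `k - j` is odd (`IsPartner`). Uniqueness is immediate, any such
choice spans the blocks as a forest, and the wall condition holds since `t_k` is the largest element
of its block. What is left for existence is that there is such an element on the required side of
`t_j`, and this is where criticality enters (`exists_of_critical`).

Suppose that all smaller elements of the block of `t = t_j` lie on the wrong side of `t`. Cutting the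
block at `t`, in the order of `C`, gives a face `G` between `C` and `p`, of codimension `k - 1`, in
which `t` has become least in its block and no other index has changed its status (`nonMin_raise`).
The flat of `G` meets `V_k` in a line through the point `y` of `p` and through a point `z` of
`V_{k-1}`. By genericity `z` lies on a `(k-1)`-critical face, represented by a critical tableau
without `t` among its attached boxes. In such a tableau `t` is placed in a later row than every
`a < t`, and is reversed once for every attached box larger than `t`, that is `k - j` times
(`before_critTabFrom`); this gives the sign of `x_t - x_a` at `z`. It vanishes at `y`, so it has the
opposite sign beyond `y`, and this is the sign that it has on `G`. But along the line the polar
order increases from `z` (`not_polarLT_of_one_le`), and every point preceding `y` lies in `V_k`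
(`PolarLT.inV`), so `G` does not precede `p` (`even_iff_mem_of_critical`).

The assertions on the order follow by induction on `k`: forgetting `H_k` turns `t_k` into a block of
its own, the order is total on the new blocks, and reversing it and inserting `t_k` next to an
element of its old block makes it total on the old blocks (`cellLT_order`).
-/

namespace Braid

/-! ### Faces, their spans and closures -/

open Classical in
/-- The elements which are not the least element of their block, the blocks of `x` being the sets
of indices at which `x` has the same value. -/
noncomputable def nonMin {n : ℕ} (x : Pt n) : Finset (Fin (n + 1)) :=
  Finset.univ.filter (fun t => ∃ a < t, x a = x t)

lemma mem_nonMin {n : ℕ} {x : Pt n} {t : Fin (n + 1)} : t ∈ nonMin x ↔ ∃ a < t, x a = x t := by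
  simp [nonMin]

lemma exists_notMem_nonMin {n : ℕ} (x : Pt n) (s : Fin (n + 1)) :
    ∃ a, a ∉ nonMin x ∧ x a = x s := by
  induction s using WellFoundedLT.induction with
  | _ s ih =>
    by_cases h : s ∈ nonMin x
    · obtain ⟨a, ha, hxa⟩ := mem_nonMin.1 h
      obtain ⟨b, hb, hxb⟩ := ih a ha
      exact ⟨b, hb, hxb.trans hxa⟩
    · exact ⟨s, h, rfl⟩

lemma eq_of_notMem_nonMin {n : ℕ} {x : Pt n} {a b : Fin (n + 1)} (ha : a ∉ nonMin x)
    (hb : b ∉ nonMin x) (h : x a = x b) : a = b := by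
  rcases lt_trichotomy a b with hl | rfl | hl
  · exact absurd (mem_nonMin.2 ⟨a, hl, h⟩) hb
  · rfl
  · exact absurd (mem_nonMin.2 ⟨b, hl, h.symm⟩) ha

lemma mem_flatThrough {n : ℕ} {x z : Pt n} :
    z ∈ flatThrough x ↔ ∀ s t, x s = x t → z s = z t := Iff.rfl

/-- A point of the flat through `x` is given by its values at the least elements of the blocks. -/
lemma finrank_flatThrough {n : ℕ} (x : Pt n) :
    Module.finrank ℝ (flatThrough x) + (nonMin x).card = n + 1 := by
  classical
  let f : flatThrough x →ₗ[ℝ] ({t // t ∈ (nonMin x)ᶜ} → ℝ) :=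
    { toFun := fun z t => z.1 t.1
      map_add' := fun _ _ => rfl
      map_smul' := fun _ _ => rfl }
  have hf : Function.Bijective f := by
    constructor
    · intro z w h
      ext s
      obtain ⟨a, ha, hxa⟩ := exists_notMem_nonMin x s
      have := congrFun h ⟨a, Finset.mem_compl.2 ha⟩
      rw [← z.2 a s hxa, ← w.2 a s hxa]
      exact this
    · intro v
      choose r hr hxr using exists_notMem_nonMin x
      refine ⟨⟨fun s => v ⟨r s, Finset.mem_compl.2 (hr s)⟩, ?_⟩, ?_⟩
      · intro s t h
        have : r s = r t := eq_of_notMem_nonMin (hr s) (hr t) (by rw [hxr, hxr, h])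
        simp [this]
      · funext t
        have : r t.1 = t.1 :=
          eq_of_notMem_nonMin (hr _) (Finset.mem_compl.1 t.2) (hxr _)
        simp [f, this]
  rw [(LinearEquiv.ofBijective f hf).finrank_eq, Module.finrank_fintype_fun_eq_card,
    Fintype.card_coe, Finset.card_compl, Fintype.card_fin]
  have := Finset.card_le_univ (nonMin x)
  rw [Fintype.card_fin] at this
  omega

lemma mem_faceOf_self {n : ℕ} (x : Pt n) : x ∈ faceOf x := fun _ _ => Iff.rfl

lemma eq_iff_of_mem_faceOf {n : ℕ} {x y : Pt n} (h : y ∈ faceOf x) (s t : Fin (n + 1)) :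
    y s = y t ↔ x s = x t := by
  have h1 := h s t
  have h2 := h t s
  constructor <;> intro e
  · exact le_antisymm (not_lt.1 (fun l => by have := h2.2 l; linarith))
      (not_lt.1 (fun l => by have := h1.2 l; linarith))
  · exact le_antisymm (not_lt.1 (fun l => by have := h2.1 l; linarith))
      (not_lt.1 (fun l => by have := h1.1 l; linarith))

/-- Points close to `x` keep the strict inequalities between the coordinates of `x`. -/
lemma exists_pos_add_smul_lt {n : ℕ} (x z : Pt n) :
    ∃ ε : ℝ, 0 < ε ∧ ∀ s t, x s < x t → x s + ε * z s < x t + ε * z t := by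
  have h : ∀ᶠ ε : ℝ in nhdsWithin 0 (Set.Ioi 0),
      ∀ s t, x s < x t → x s + ε * z s < x t + ε * z t := by
    rw [Filter.eventually_all]
    intro s
    rw [Filter.eventually_all]
    intro t
    by_cases hst : x s < x t
    · have hc : Continuous fun ε : ℝ => (x t + ε * z t) - (x s + ε * z s) := by fun_prop
      have := (hc.tendsto 0).eventually (lt_mem_nhds (a := 0) (by simpa using hst))
      filter_upwards [nhdsWithin_le_nhds this] with ε hε _
      linarith
    · exact Filter.Eventually.of_forall fun _ h => absurd h hst
  obtain ⟨ε, h1, h2⟩ := (h.and self_mem_nhdsWithin).exists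
  exact ⟨ε, h2, h1⟩

lemma vectorSpan_faceOf {n : ℕ} (x : Pt n) : vectorSpan ℝ (faceOf x) = flatThrough x := by
  apply le_antisymm
  · rw [vectorSpan_def, Submodule.span_le]
    rintro _ ⟨y, hy, z, hz, rfl⟩ s t hst
    have h1 := (eq_iff_of_mem_faceOf hy s t).2 hst
    have h2 := (eq_iff_of_mem_faceOf hz s t).2 hst
    simp [h1, h2]
  · intro z hz
    obtain ⟨ε, hε, h⟩ := exists_pos_add_smul_lt x z
    have hm : x + ε • z ∈ faceOf x := by
      intro s t
      simp only [Pi.add_apply, Pi.smul_apply, smul_eq_mul]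
      refine ⟨fun hl => ?_, h s t⟩
      rcases lt_trichotomy (x s) (x t) with h1 | h1 | h1
      · exact h1
      · rw [hz s t h1, h1] at hl
        exact absurd hl (lt_irrefl _)
      · exact absurd (h t s h1) (not_lt.2 hl.le)
    have := vsub_mem_vectorSpan ℝ hm (mem_faceOf_self x)
    have h2 : ε⁻¹ • ((x + ε • z) -ᵥ x) = z := by
      rw [vsub_eq_sub, add_sub_cancel_left, smul_smul, inv_mul_cancel₀ hε.ne', one_smul]
    rw [← h2]
    exact Submodule.smul_mem _ _ this

lemma codim_faceOf {n : ℕ} (x : Pt n) : codim (faceOf x) = (nonMin x).card := by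
  rw [codim, vectorSpan_faceOf]
  exact Nat.sub_eq_of_eq_add' (finrank_flatThrough x).symm

lemma affineSpan_faceOf {n : ℕ} (x : Pt n) :
    (affineSpan ℝ (faceOf x) : Set (Pt n)) = flatThrough x := by
  have hx : x ∈ affineSpan ℝ (faceOf x) := subset_affineSpan ℝ _ (mem_faceOf_self x)
  ext z
  have h := AffineSubspace.vsub_right_mem_direction_iff_mem hx z
  rw [direction_affineSpan, vectorSpan_faceOf, vsub_eq_sub] at h
  have hxx : x ∈ flatThrough x := fun _ _ h => h
  rw [SetLike.mem_coe, ← h, SetLike.mem_coe]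
  exact ⟨fun hz => by simpa using add_mem hz hxx, fun hz => sub_mem hz hxx⟩

lemma closure_faceOf {n : ℕ} (g : Pt n) :
    closure (faceOf g) = {w | ∀ s t, g s ≤ g t → w s ≤ w t} := by
  apply le_antisymm
  · apply closure_minimal
    · intro w hw s t hst
      exact not_lt.1 fun h => not_lt.2 hst ((hw t s).1 h)
    · simp only [Set.ofPred_forall]
      refine isClosed_iInter fun s => isClosed_iInter fun t => isClosed_iInter fun _ => ?_
      exact isClosed_le (continuous_apply s) (continuous_apply t)
  · intro w hw
    have ht : Filter.Tendsto (fun ε : ℝ => w + ε • g) (nhdsWithin 0 (Set.Ioi 0)) (nhds w) := by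
      have hc : Continuous fun ε : ℝ => w + ε • g := by fun_prop
      have := hc.tendsto 0
      simp only [zero_smul, add_zero] at this
      exact this.mono_left nhdsWithin_le_nhds
    refine mem_closure_of_tendsto ht ?_
    filter_upwards [self_mem_nhdsWithin] with ε hε s t
    have hε' : 0 < ε := hε
    simp only [Pi.add_apply, Pi.smul_apply, smul_eq_mul]
    constructor
    · intro hl
      by_contra hc
      have h1 := hw t s (not_lt.1 hc)
      nlinarith [not_lt.1 hc]
    · intro hl
      have h1 := hw s t hl.le
      nlinarith

lemma faceLE_faceOf {n : ℕ} {g x : Pt n} :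
    FaceLE (faceOf g) (faceOf x) ↔ ∀ s t, g s ≤ g t → x s ≤ x t := by
  constructor
  · intro h
    have := h (subset_closure (mem_faceOf_self x))
    rwa [closure_faceOf] at this
  · intro h
    rw [FaceLE, closure_faceOf, closure_faceOf]
    exact fun w hw s t hst => hw s t (h s t hst)

lemma subset_hyp_iff {n : ℕ} {x : Pt n} {H : HPair n} : faceOf x ⊆ hyp H ↔ x H.1 = x H.2 :=
  ⟨fun h => h (mem_faceOf_self x), fun h _ hy => (eq_iff_of_mem_faceOf hy _ _).2 h⟩

lemma separates_iff {n : ℕ} {c : Pt n} {H : HPair n} (hH : H.1 < H.2) :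
    Separates H (faceOf c) (baseChamber n) ↔ c H.2 < c H.1 := by
  constructor
  · intro h
    have hb : (fun i : Fin (n + 1) => (i.1 : ℝ)) ∈ baseChamber n := fun a b hab =>
      Nat.cast_lt.2 (Fin.lt_def.1 hab)
    have h1 := h c (mem_faceOf_self c) _ hb
    have h2 : ((H.1.1 : ℝ)) < H.2.1 := by exact_mod_cast hH
    by_contra hc
    nlinarith [mul_nonneg (sub_nonneg.2 (not_lt.1 hc)) (sub_nonneg.2 h2.le)]
  · intro h y hy w hw
    have h1 : y H.2 < y H.1 := (hy _ _).2 h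
    have h2 : w H.1 < w H.2 := hw hH
    exact mul_neg_of_pos_of_neg (sub_pos.2 h1) (sub_neg.2 h2)

lemma hypBefore_iff {n : ℕ} {c : Pt n} {H H' : HPair n} :
    HypBefore (faceOf c) H H' ↔ c H.1 < c H'.1 :=
  ⟨fun h => h c (mem_faceOf_self c), fun h _ hy => (hy _ _).2 h⟩

/-- Two neighbours in the order of the coordinates of `c` span a wall of the chamber of `c`. -/
lemma isWall_of_adjacent {n : ℕ} {c : Pt n} (hc : Function.Injective c) {s t : Fin (n + 1)}
    (hst : s < t) (hlt : c s < c t) (hadj : ∀ u, c s < c u → ¬ c u < c t) :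
    IsWall (s, t) (faceOf c) := by
  have hg : ∀ u, u ≠ t → Function.update c t (c s) u = c u := fun u hu => by simp [hu]
  have hgt : Function.update c t (c s) t = c s := by simp
  refine ⟨faceOf (Function.update c t (c s)), ⟨_, rfl⟩, ?_, ?_, ?_⟩
  · rw [codim_faceOf, Finset.card_eq_one]
    refine ⟨t, ?_⟩
    ext u
    rw [mem_nonMin, Finset.mem_singleton]
    constructor
    · rintro ⟨a, hau, h⟩
      by_contra hut
      rw [hg u hut] at h
      by_cases hat : a = t
      · rw [hat, hgt] at h
        have := hc h
        omega
      · rw [hg a hat] at h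
        exact hau.ne (hc h)
    · rintro rfl
      exact ⟨s, hst, by rw [hg s hst.ne, hgt]⟩
  · rw [faceLE_faceOf]
    intro a b hab
    by_cases ha : a = t <;> by_cases hb : b = t
    · rw [ha, hb]
    · rw [ha, hg b hb, hgt]
      rw [ha] at hab
      exact hlt.le.trans hab
    · rw [hg a ha, hb, hgt]
      rw [hb] at hab
      by_contra hcon
      exact hadj a (not_le.1 hcon) (lt_of_le_of_ne hab fun h => ha (hc h))
    · rwa [hg a ha, hg b hb]
  · rw [subset_hyp_iff]
    simp [hst.ne]

/-! ### The order of a tuple of hyperplanes -/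

lemma IsNbc.init {n k : ℕ} {H : Fin (k + 1) → HPair n} (h : IsNbc (k + 1) H) :
    IsNbc k (Fin.init H) :=
  ⟨fun j => h.1 j.castSucc, fun _ _ hij => h.2 (Fin.castSucc_lt_castSucc_iff.2 hij)⟩

lemma IsNbc.fst_lt_last {n k : ℕ} {H : Fin (k + 1) → HPair n} (h : IsNbc (k + 1) H)
    (j : Fin k) : (H j.castSucc).1 < (H (Fin.last k)).2 ∧ (H j.castSucc).2 < (H (Fin.last k)).2 :=
  have h2 := h.2 (Fin.castSucc_lt_last j)
  ⟨(h.1 _).trans h2, h2⟩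

lemma cellLT_succ_of_ne {n k : ℕ} (H : Fin (k + 1) → HPair n) {a b : Fin (n + 1)}
    (ha : a ≠ (H (Fin.last k)).2) (hb : b ≠ (H (Fin.last k)).2) :
    cellLT (k + 1) H a b ↔ cellLT k (Fin.init H) b a := by
  simp [cellLT, ha, hb]

/-- `t_j` and `s_j` are inserted as neighbours, `t_j` first, and then reversed `k - j` times. -/
lemma cellLT_pair {n : ℕ} : ∀ {k : ℕ} {H : Fin k → HPair n}, IsNbc k H → ∀ j : Fin k,
    ((-1 : ℤ) ^ (k - (j.1 + 1)) = 1 → cellLT k H (H j).2 (H j).1) ∧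
    ((-1 : ℤ) ^ (k - (j.1 + 1)) = -1 → cellLT k H (H j).1 (H j).2) := by
  intro k
  induction k with
  | zero => exact fun _ j => j.elim0
  | succ k ih =>
    intro H h j
    induction j using Fin.lastCases with
    | last => simp [cellLT]
    | cast j =>
      obtain ⟨h1, h2⟩ := ih h.init j
      have hlt := h.fst_lt_last j
      have e : k + 1 - (j.castSucc.1 + 1) = (k - (j.1 + 1)) + 1 := by
        have := j.2
        simp only [Fin.val_castSucc]
        omega
      rw [cellLT_succ_of_ne H hlt.1.ne hlt.2.ne, cellLT_succ_of_ne H hlt.2.ne hlt.1.ne, e, pow_succ]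
      refine ⟨fun hp => h2 ?_, fun hp => h1 ?_⟩ <;> linarith

/-- If the hyperplanes of the tuple span the equivalence relation `x a = x b` as a forest, in which
each element that is not the least one of its class is joined to a smaller one, then the relation
of the tuple is a strict total order on every class, and relates elements of the same class
only. -/
lemma cellLT_order {n : ℕ} : ∀ {k : ℕ} {H : Fin k → HPair n}, IsNbc k H →
    ∀ {α : Type} (x : Fin (n + 1) → α), (∀ j, x (H j).1 = x (H j).2) →
    (∀ a b, a < b → x a = x b → ∃ j, (H j).2 = b) →
    (∀ a b, cellLT k H a b → x a = x b) ∧ (∀ a, ¬ cellLT k H a a) ∧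
    (∀ a b c, cellLT k H a b → cellLT k H b c → cellLT k H a c) ∧
    (∀ a b, x a = x b → cellLT k H a b ∨ a = b ∨ cellLT k H b a) := by
  intro k
  induction k with
  | zero =>
    intro H _ α x _ hx
    refine ⟨fun _ _ h => h.elim, fun _ h => h, fun _ _ _ h => h.elim, fun a b hab => ?_⟩
    rcases lt_trichotomy a b with h | h | h
    · exact (hx a b h hab).elim fun j _ => j.elim0
    · exact Or.inr (Or.inl h)
    · exact (hx b a h hab.symm).elim fun j _ => j.elim0
  | succ k ih =>
    intro H h α x hH hx
    -- Removing the last hyperplane makes its larger index a class of its own.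
    obtain ⟨h1, h2, h3, h4⟩ := ih h.init
      (fun a => if a = (H (Fin.last k)).2 then none else some (x a))
      (fun j => (if_neg (h.fst_lt_last j).1.ne).trans
        ((congrArg some (hH j.castSucc)).trans (if_neg (h.fst_lt_last j).2.ne).symm))
      (fun a b hab hxab => by
        by_cases hb : b = (H (Fin.last k)).2
        · have ha : a ≠ (H (Fin.last k)).2 := hb ▸ hab.ne
          simp [hb, ha] at hxab
        · have ha : a ≠ (H (Fin.last k)).2 := fun ha => by simp [hb, ha] at hxab
          simp only [if_neg ha, if_neg hb, Option.some.injEq] at hxab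
          obtain ⟨j, hj⟩ := hx a b hab hxab
          induction j using Fin.lastCases with
          | last => exact absurd hj.symm hb
          | cast j => exact ⟨j, hj⟩)
    have hst : (H (Fin.last k)).1 ≠ (H (Fin.last k)).2 := (h.1 _).ne
    have hl := hH (Fin.last k)
    simp only [cellLT]
    generalize (H (Fin.last k)).1 = s at *
    generalize (H (Fin.last k)).2 = t at *
    generalize cellLT k (Fin.init H) = r at *
    have key : ∀ a b, r a b → a ≠ t ∧ b ≠ t ∧ x a = x b := by
      intro a b hab
      have hne : ∀ {a b : Fin (n + 1)}, (if a = t then none else some (x a)) =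
          (if b = t then none else some (x b)) → a = t → b = t := by
        intro a b e ha
        by_contra hb
        simp [ha, hb] at e
      have e := h1 a b hab
      by_cases ha : a = t
      · have hb := hne e ha
        rcases h4 a b e with _ | _ | _ <;> subst ha hb <;> exact (h2 _ hab).elim
      · have hb : b ≠ t := fun hb => ha (hne e.symm hb)
        simp only [if_neg ha, if_neg hb, Option.some.injEq] at e
        exact ⟨ha, hb, e⟩
    have tot : ∀ a b, a ≠ t → b ≠ t → x a = x b → r a b ∨ a = b ∨ r b a := by
      intro a b ha hb e
      exact h4 a b (by simp [ha, hb, e])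
    clear h1 h4 ih hx hH
    refine ⟨?_, ?_, ?_, ?_⟩
    · rintro a b (⟨_, _, hr⟩ | ⟨rfl, rfl | hr⟩ | ⟨rfl, hr⟩)
      · exact (key _ _ hr).2.2.symm
      · exact hl.symm
      · exact hl.symm.trans (key _ _ hr).2.2.symm
      · exact (key _ _ hr).2.2.symm.trans hl
    · rintro a (⟨_, _, hr⟩ | ⟨rfl, h5 | hr⟩ | ⟨rfl, hr⟩)
      · exact h2 _ hr
      · exact hst h5.symm
      · exact (key _ _ hr).1 rfl
      · exact (key _ _ hr).2.1 rfl
    · rintro a b c (⟨ha, hb, hr⟩ | ⟨ha, hr⟩ | ⟨hb, hr⟩) (⟨hb', hc, hr'⟩ | ⟨hb', hr'⟩ | ⟨hc, hr'⟩)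
      all_goals grind
    · intro a b e
      by_cases ha : a = t <;> by_cases hb : b = t
      · exact Or.inr (Or.inl (ha.trans hb.symm))
      · subst ha
        rcases tot b s hb hst (e.symm.trans hl.symm) with h5 | h5 | h5 <;> simp [h5]
      · subst hb
        rcases tot a s ha hst (e.trans hl.symm) with h5 | h5 | h5 <;> simp [h5]
      · rcases tot a b ha hb e with h5 | h5 | h5 <;> simp [h5, ha, hb]

/-- No element lies strictly between `t_k` and `s_k`. -/
lemma cellLT_adjacent {n k : ℕ} {H : Fin (k + 1) → HPair n} (h : IsNbc (k + 1) H)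
    {α : Type} (x : Fin (n + 1) → α) (hH : ∀ j, x (H j).1 = x (H j).2)
    (hx : ∀ a b, a < b → x a = x b → ∃ j, (H j).2 = b) (c : Fin (n + 1))
    (h1 : cellLT (k + 1) H (H (Fin.last k)).2 c) : ¬ cellLT (k + 1) H c (H (Fin.last k)).1 := by
  intro h2
  obtain ⟨-, irr, tr, -⟩ := cellLT_order h x hH hx
  have hst : (H (Fin.last k)).1 ≠ (H (Fin.last k)).2 := (h.1 _).ne
  have hct : c ≠ (H (Fin.last k)).2 := fun e => irr _ (e ▸ h1)
  have h1' := h1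
  simp only [cellLT, ne_eq, not_true_eq_false, false_and, true_and, false_or, hct, or_false] at h1'
  rcases h1' with rfl | h1'
  · exact irr _ h2
  · rw [cellLT_succ_of_ne H hct hst] at h2
    have h3 := (cellLT_succ_of_ne H hst hct).2 h1'
    have h4 := (cellLT_succ_of_ne H hct hst).2 h2
    exact irr _ (tr _ _ _ h3 h4)

/-! ### Tableaux -/

/-- The entry `a` lies in an earlier row of `T` than the entry `t`. -/
def Before {n : ℕ} (T : Tab n) (a t : Fin (n + 1)) : Prop :=
  ∃ u v : ℕ, u < v ∧ (∃ r, T[u]? = some r ∧ a ∈ r) ∧ ∃ r, T[v]? = some r ∧ t ∈ r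

lemma Before.append {n : ℕ} {T : Tab n} {a t : Fin (n + 1)} (h : Before T a t) (T' : Tab n) :
    Before (T ++ T') a t := by
  obtain ⟨u, v, huv, ⟨r, hr, ha⟩, r', hr', ht⟩ := h
  exact ⟨u, v, huv,
    ⟨r, by rw [List.getElem?_append_left (List.getElem?_eq_some_iff.1 hr).1, hr], ha⟩,
    r', by rw [List.getElem?_append_left (List.getElem?_eq_some_iff.1 hr').1, hr'], ht⟩

lemma Before.prepend {n : ℕ} {T : Tab n} {a t : Fin (n + 1)} (h : Before T a t) (T' : Tab n) :
    Before (T' ++ T) a t := by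
  obtain ⟨u, v, huv, ⟨r, hr, ha⟩, r', hr', ht⟩ := h
  refine ⟨T'.length + u, T'.length + v, by omega, ⟨r, ?_, ha⟩, r', ?_, ht⟩ <;>
    rw [List.getElem?_append_right (by omega), Nat.add_sub_cancel_left] <;> assumption

lemma Before.reverse {n : ℕ} {T : Tab n} {a t : Fin (n + 1)} (h : Before T a t) :
    Before T.reverse t a := by
  obtain ⟨u, v, huv, ⟨r, hr, ha⟩, r', hr', ht⟩ := h
  have h1 := (List.getElem?_eq_some_iff.1 hr).1
  have h2 := (List.getElem?_eq_some_iff.1 hr').1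
  refine ⟨T.length - 1 - v, T.length - 1 - u, by omega, ⟨r', ?_, ht⟩, r, ?_, ha⟩
  · rw [List.getElem?_reverse (by omega), ← hr']
    congr 1
    omega
  · rw [List.getElem?_reverse (by omega), ← hr]
    congr 1
    omega

lemma Before.attach {n : ℕ} {T : Tab n} {a t : Fin (n + 1)} (h : Before T a t) (i : ℕ)
    (j : Fin (n + 1)) : Before (attach T i j) a t := by
  have key : ∀ (u : ℕ) (b : Fin (n + 1)), (∃ r, T[u]? = some r ∧ b ∈ r) →
      ∃ r, (Braid.attach T i j)[u]? = some r ∧ b ∈ r := by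
    rintro u b ⟨r, hr, hb⟩
    rw [Braid.attach, List.getElem?_modify, hr]
    by_cases hi : i = u <;> simp [hi, hb]
  obtain ⟨u, v, huv, h1, h2⟩ := h
  exact ⟨u, v, huv, key _ _ h1, key _ _ h2⟩

lemma before_append {n : ℕ} {T T' : Tab n} {a t : Fin (n + 1)} (ha : a ∈ T.flatten)
    (ht : t ∈ T'.flatten) : Before (T ++ T') a t := by
  obtain ⟨r, hr, har⟩ := List.mem_flatten.1 ha
  obtain ⟨r', hr', htr⟩ := List.mem_flatten.1 ht
  obtain ⟨u, hu⟩ := List.mem_iff_getElem?.1 hr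
  obtain ⟨v, hv⟩ := List.mem_iff_getElem?.1 hr'
  have hul := (List.getElem?_eq_some_iff.1 hu).1
  refine ⟨u, T.length + v, by omega, ⟨r, ?_, har⟩, r', ?_, htr⟩
  · rw [List.getElem?_append_left hul, hu]
  · rw [List.getElem?_append_right (by omega), Nat.add_sub_cancel_left, hv]

lemma mem_flatten_column {n b e : ℕ} {t : Fin (n + 1)} :
    t ∈ (column n b e).flatten ↔ b ≤ t.1 ∧ t.1 < e := by
  simp [column]

lemma before_column {n b e : ℕ} {a t : Fin (n + 1)} (hba : b ≤ a.1) (hat : a < t)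
    (hte : t.1 < e) : Before (column n b e) a t := by
  have hsort : (column n b e).Pairwise (fun r r' => ∀ a ∈ r, ∀ t ∈ r', a < t) := by
    rw [column, List.pairwise_map]
    refine ((List.pairwise_lt_finRange (n + 1)).filter _).imp ?_
    simp
  have ha : a ∈ (column n b e).flatten := mem_flatten_column.2 ⟨hba, by omega⟩
  have ht : t ∈ (column n b e).flatten := mem_flatten_column.2 ⟨by omega, hte⟩
  obtain ⟨r, hr, har⟩ := List.mem_flatten.1 ha
  obtain ⟨r', hr', htr⟩ := List.mem_flatten.1 ht
  obtain ⟨u, hu, rfl⟩ := List.mem_iff_getElem.1 hr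
  obtain ⟨v, hv, rfl⟩ := List.mem_iff_getElem.1 hr'
  refine ⟨u, v, ?_, ⟨_, List.getElem?_eq_getElem hu, har⟩, _, List.getElem?_eq_getElem hv, htr⟩
  rcases lt_trichotomy u v with h | rfl | h
  · exact h
  · simp only [column, List.getElem_map, List.mem_singleton] at har htr
    exact absurd (har.trans htr.symm) hat.ne
  · exact absurd (List.pairwise_iff_getElem.1 hsort v u hv hu h t htr a har) (not_lt.2 hat.le)

lemma mem_flatten_attach {n : ℕ} {T : Tab n} {i : ℕ} {j a : Fin (n + 1)}
    (h : a ∈ (attach T i j).flatten) : a ∈ T.flatten ∨ a = j := by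
  obtain ⟨r, hr, ha⟩ := List.mem_flatten.1 h
  obtain ⟨u, hu⟩ := List.mem_iff_getElem?.1 hr
  rw [attach, List.getElem?_modify] at hu
  obtain ⟨r', hr', rfl⟩ := Option.map_eq_some_iff.1 hu
  have hm : r' ∈ T := List.mem_iff_getElem?.2 ⟨u, hr'⟩
  split_ifs at ha
  · rcases List.mem_append.1 ha with h1 | h1
    · exact Or.inl (List.mem_flatten.2 ⟨r', hm, h1⟩)
    · exact Or.inr (List.mem_singleton.1 h1)
  · exact Or.inl (List.mem_flatten.2 ⟨r', hm, ha⟩)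

lemma mem_flatten_critTabFrom {n : ℕ} {a : Fin (n + 1)} (L : List (Fin (n + 1) × ℕ)) :
    ∀ (R : Tab n) (m : ℕ), (L.Pairwise fun p q => p.1 < q.1) → (∀ p ∈ L, m ≤ p.1.1) →
    a ∈ (critTabFrom R m L).flatten → a ∈ R.flatten ∨ m ≤ a.1 := by
  induction L with
  | nil =>
    intro R m _ _ h
    rw [critTabFrom, List.flatten_append, List.mem_append, mem_flatten_column] at h
    exact h.imp_right And.left
  | cons q L ih =>
    obtain ⟨j, i⟩ := q
    intro R m hs hm h
    have hmj : m ≤ j.1 := hm _ List.mem_cons_self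
    rw [List.pairwise_cons] at hs
    rcases ih _ _ hs.2 (fun p hp => hs.1 p hp) h with h1 | h1
    · rcases mem_flatten_attach h1 with h2 | rfl
      · rw [List.mem_flatten] at h2
        simp only [List.mem_reverse] at h2
        rw [← List.mem_flatten, List.flatten_append, List.mem_append, mem_flatten_column] at h2
        exact h2.imp_right And.left
      · exact Or.inr hmj
    · exact Or.inr (hmj.trans ((Nat.le_succ _).trans h1))

/-- Every attached box reverses the order of the rows that are already there. -/
lemma Before.critTabFrom {n : ℕ} (L : List (Fin (n + 1) × ℕ)) :
    ∀ (R : Tab n) (m : ℕ) (a t : Fin (n + 1)), Before R a t →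
    (Even L.length → Before (critTabFrom R m L) a t) ∧
    (¬ Even L.length → Before (critTabFrom R m L) t a) := by
  induction L with
  | nil => exact fun R m a t h => ⟨fun _ => h.append _, fun h' => absurd (by simp) h'⟩
  | cons q L ih =>
    obtain ⟨j, i⟩ := q
    intro R m a t h
    obtain ⟨h1, h2⟩ := ih _ (j.1 + 1) _ _ ((h.append (column n m j.1)).reverse.attach i j)
    rw [List.length_cons, Nat.even_add_one, not_not]
    exact ⟨h2, h1⟩

/-- An entry `t` that is not one of the attached boxes is placed in a later row than all smaller
entries, and the order of the rows is reversed afterwards once for each attached box `j > t`. -/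
lemma before_critTabFrom {n : ℕ} {a t : Fin (n + 1)} (hat : a < t)
    (L : List (Fin (n + 1) × ℕ)) :
    ∀ (R : Tab n) (m : ℕ), (L.Pairwise fun p q => p.1 < q.1) → (∀ p ∈ L, m ≤ p.1.1) →
    m ≤ t.1 → (∀ p ∈ L, p.1 ≠ t) → a ∈ (critTabFrom R m L).flatten →
    (Even (L.countP fun p => t < p.1) → Before (critTabFrom R m L) a t) ∧
    (¬ Even (L.countP fun p => t < p.1) → Before (critTabFrom R m L) t a) := by
  induction L with
  | nil =>
    intro R m _ _ hmt _ ha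
    refine ⟨fun _ => ?_, fun h => absurd (by simp) h⟩
    rw [critTabFrom]
    by_cases ham : m ≤ a.1
    · exact (before_column ham hat t.2).prepend R
    · rw [critTabFrom, List.flatten_append, List.mem_append, mem_flatten_column] at ha
      exact before_append (ha.resolve_right fun h => ham h.1) (mem_flatten_column.2 ⟨hmt, t.2⟩)
  | cons q L ih =>
    obtain ⟨j, i⟩ := q
    intro R m hs hm hmt ht ha
    have hmj : m ≤ j.1 := hm _ List.mem_cons_self
    have hjt : j ≠ t := ht _ List.mem_cons_self
    rw [List.pairwise_cons] at hs
    rcases lt_or_gt_of_ne hjt with hlt | hlt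
    · rw [List.countP_cons_of_neg (by simpa using hlt.le)]
      exact ih _ _ hs.2 (fun p hp => hs.1 p hp) hlt
        (fun p hp => ht p (List.mem_cons_of_mem _ hp)) ha
    · have hall : ∀ p ∈ L, t < p.1 := fun p hp => hlt.trans (hs.1 p hp)
      rw [List.countP_cons_of_pos (by simpa using hlt),
        List.countP_eq_length.2 (by simpa using hall), Nat.even_add_one, not_not]
      have hB : Before (R ++ column n m j.1) a t := by
        by_cases ham : m ≤ a.1
        · exact (before_column ham hat hlt).prepend R
        · exact before_append
            ((mem_flatten_critTabFrom _ R m (List.pairwise_cons.2 hs) hm ha).resolve_right ham)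
            (mem_flatten_column.2 ⟨hmt, hlt⟩)
      have := Before.critTabFrom L _ (j.1 + 1) _ _ (hB.reverse.attach i j)
      exact ⟨this.2, this.1⟩

lemma CritCode.before_tab {n k : ℕ} (c : CritCode n k) (hT : IsTableau c.tab)
    {a t : Fin (n + 1)} (hat : a < t) (ht : t ∉ Set.range c.j) :
    (Even (Finset.univ.filter fun h => t < c.j h).card → Before c.tab a t) ∧
    (¬ Even (Finset.univ.filter fun h => t < c.j h).card → Before c.tab t a) := by
  have hcount : (List.ofFn fun h => (c.j h, c.i h)).countP (fun p => t < p.1) =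
      (Finset.univ.filter fun h => t < c.j h).card := by
    rw [List.ofFn_eq_map, List.countP_map, List.countP_eq_length_filter,
      ← List.toFinset_card_of_nodup ((List.nodup_finRange k).filter _)]
    congr 1
    ext h
    simp
  rw [← hcount]
  refine before_critTabFrom hat _ [] 0 ?_ (fun _ _ => Nat.zero_le _) (Nat.zero_le _) ?_ ?_
  · rw [List.pairwise_ofFn]
    exact fun _ _ h => c.strictMono h
  · simp only [List.mem_ofFn, forall_exists_index, forall_apply_eq_imp_iff]
    exact fun h e => ht ⟨h, e⟩
  · exact hT.1.mem_iff.2 (List.mem_finRange a)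

lemma IsTableau.rowOf_eq {n : ℕ} {T : Tab n} (hT : IsTableau T) {i : ℕ} {r : List (Fin (n + 1))}
    {a : Fin (n + 1)} (hr : T[i]? = some r) (ha : a ∈ r) : rowOf T a = i := by
  obtain ⟨hi, rfl⟩ := List.getElem?_eq_some_iff.1 hr
  have hd := (List.nodup_flatten.1 (hT.1.nodup_iff.2 (List.nodup_finRange _))).2
  rw [rowOf, List.findIdx_eq hi]
  refine ⟨by simpa using ha, fun j hj => ?_⟩
  simp only [decide_eq_false_iff_not]
  intro h
  exact List.pairwise_iff_getElem.1 hd j i (hj.trans hi) hi hj h ha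

lemma Before.rowOf_lt {n : ℕ} {T : Tab n} (hT : IsTableau T) {a t : Fin (n + 1)}
    (h : Before T a t) : rowOf T a < rowOf T t := by
  obtain ⟨u, v, huv, ⟨r, hr, ha⟩, r', hr', ht⟩ := h
  rwa [hT.rowOf_eq hr ha, hT.rowOf_eq hr' ht]

lemma IsTableau.rowOf_lt_length {n : ℕ} {T : Tab n} (hT : IsTableau T) (a : Fin (n + 1)) :
    rowOf T a < T.length := by
  obtain ⟨r, hr, ha⟩ := List.mem_flatten.1 (hT.1.mem_iff.2 (List.mem_finRange a))
  obtain ⟨u, hu⟩ := List.mem_iff_getElem?.1 hr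
  rw [hT.rowOf_eq hu ha]
  exact (List.getElem?_eq_some_iff.1 hu).1

/-- The rows of a tableau correspond to the least elements of the blocks. -/
lemma Represents.length_add_card {n : ℕ} {T : Tab n} {x : Pt n} (h : Represents T (faceOf x)) :
    T.length + (nonMin x).card = n + 1 := by
  classical
  have hx := (h.2 x).1 (mem_faceOf_self x)
  have hb : Function.Bijective
      (fun t : {t // t ∈ (nonMin x)ᶜ} => (⟨rowOf T t.1, h.1.rowOf_lt_length _⟩ : Fin T.length)) := by
    constructor
    · intro a b hab
      exact Subtype.ext (eq_of_notMem_nonMin (Finset.mem_compl.1 a.2) (Finset.mem_compl.1 b.2)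
        ((hx _ _).1.2 (Fin.mk.inj hab)))
    · intro i
      obtain ⟨b, hb⟩ := List.exists_mem_of_ne_nil _ (h.1.2 _ (List.getElem_mem i.2))
      obtain ⟨a, ha, hab⟩ := exists_notMem_nonMin x b
      refine ⟨⟨a, Finset.mem_compl.2 ha⟩, Fin.ext ?_⟩
      change rowOf T a = i.1
      rw [(hx a b).1.1 hab]
      exact h.1.rowOf_eq (List.getElem?_eq_getElem i.2) hb
  have := Fintype.card_of_bijective hb
  rw [Fintype.card_coe, Finset.card_compl, Fintype.card_fin, Fintype.card_fin] at this
  have h2 := Finset.card_le_univ (nonMin x)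
  rw [Fintype.card_fin] at h2
  omega

/-- The sign of `x_t - x_a` on a critical face, if `t` is the least element of its block and
`a < t`. -/
lemma Represents.lt_iff_even {n k : ℕ} {c : CritCode n k} {x : Pt n}
    (h : Represents c.tab (faceOf x)) (hk : (nonMin x).card = k) {a t : Fin (n + 1)} (hat : a < t)
    (ht : t ∉ nonMin x) :
    (Even ((nonMin x).filter fun s => t < s).card → x a < x t) ∧
    (¬ Even ((nonMin x).filter fun s => t < s).card → x t < x a) := by
  classical
  have hx := (h.2 x).1 (mem_faceOf_self x)
  -- Entries that are not attached share their row with no smaller entry; the reverse inclusion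
  -- holds because both sets have `k` elements.
  have hsub : nonMin x ⊆ Finset.univ.image c.j := by
    intro s hs
    obtain ⟨b, hbs, e⟩ := mem_nonMin.1 hs
    by_contra hn
    have := c.before_tab h.1 hbs (fun ⟨i, hi⟩ =>
      hn (hi ▸ Finset.mem_image_of_mem _ (Finset.mem_univ i)))
    have e' := (hx b s).1.1 e
    by_cases hev : Even (Finset.univ.filter fun h => s < c.j h).card
    · exact absurd e' ((this.1 hev).rowOf_lt h.1).ne
    · exact absurd e' ((this.2 hev).rowOf_lt h.1).ne'
  have heq : nonMin x = Finset.univ.image c.j := by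
    refine Finset.eq_of_subset_of_card_le hsub ?_
    rw [hk, Finset.card_image_of_injective _ c.strictMono.injective, Finset.card_fin]
  have hcard : ((nonMin x).filter fun s => t < s).card =
      (Finset.univ.filter fun h => t < c.j h).card := by
    rw [heq, Finset.filter_image, Finset.card_image_of_injective _ c.strictMono.injective]
  have := c.before_tab h.1 hat (fun ⟨i, hi⟩ =>
    ht (heq ▸ hi ▸ Finset.mem_image_of_mem _ (Finset.mem_univ i)))
  rw [hcard]
  exact ⟨fun he => (hx _ _).2.2 ((this.1 he).rowOf_lt h.1),
    fun he => (hx _ _).2.2 ((this.2 he).rowOf_lt h.1)⟩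

/-! ### Polar coordinates -/

lemma tailNorm_nonneg {n : ℕ} (y : Fin n → ℝ) (m : ℕ) : 0 ≤ tailNorm y m := Real.sqrt_nonneg _

lemma tailNorm_eq_zero_iff {n : ℕ} {y : Fin n → ℝ} {m : ℕ} : tailNorm y m = 0 ↔ InV m y := by
  have hn : ∀ i : Fin n, 0 ≤ if m ≤ i.1 then y i ^ 2 else 0 := fun i => by positivity
  rw [tailNorm, Real.sqrt_eq_zero (Finset.sum_nonneg fun i _ => hn i),
    Finset.sum_eq_zero_iff_of_nonneg fun i _ => hn i]
  simp [InV]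

lemma tailNorm_eq_of_inV {n : ℕ} {y : Fin n → ℝ} {c : Fin n} (hy : InV (c.1 + 1) y)
    (hc : 0 ≤ y c) : tailNorm y c.1 = y c := by
  rw [tailNorm, Finset.sum_eq_single c]
  · simp [Real.sqrt_sq hc]
  · intro i _ hic
    split_ifs with h
    · rw [hy i (by omega)]
      simp
    · rfl
  · simp

lemma polar_of_ne_zero {n : ℕ} (y : Fin n → ℝ) {m : Fin n} (hm : m.1 ≠ 0) :
    polar y m = Complex.arg ⟨y ⟨m.1 - 1, by omega⟩, tailNorm y m.1⟩ := if_neg hm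

lemma polar_nonneg {n : ℕ} (y : Fin n → ℝ) (m : Fin n) : 0 ≤ polar y m := by
  rw [polar]
  split_ifs
  · exact tailNorm_nonneg _ _
  · exact Complex.arg_nonneg_iff.2 (tailNorm_nonneg _ _)

lemma polar_eq_zero_iff {n : ℕ} {y : Fin n → ℝ} (hy : ∀ i, 0 ≤ y i) {m : Fin n} (hm : m.1 ≠ 0) :
    polar y m = 0 ↔ InV m.1 y := by
  rw [polar_of_ne_zero y hm, Complex.arg_eq_zero_iff, ← tailNorm_eq_zero_iff]
  exact and_iff_right (hy _)

lemma PolarLT.irrefl {n : ℕ} (y : Fin n → ℝ) : ¬ PolarLT y y := fun ⟨_, _, h⟩ => lt_irrefl _ h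

/-- Points that precede a point of `V_k` in the polar order lie in `V_k`. -/
lemma PolarLT.inV {n k : ℕ} (hk : k ≠ 0) {q y : Fin n → ℝ} (hq : ∀ i, 0 ≤ q i)
    (hy : ∀ i, 0 ≤ y i) (hyk : InV k y) (h : PolarLT q y) : InV k q := by
  obtain ⟨m, hm, hlt⟩ := h
  rcases le_or_gt k m.1 with hkm | hmk
  · rw [(polar_eq_zero_iff hy (by omega)).2 (fun i hi => hyk i (hkm.trans hi))] at hlt
    exact absurd hlt (not_lt.2 (polar_nonneg _ _))
  · intro i hi
    let l : Fin n := ⟨k, by omega⟩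
    have h1 : polar q l = 0 := (hm l hmk).trans ((polar_eq_zero_iff hy hk).2 hyk)
    exact (polar_eq_zero_iff hq hk).1 h1 i hi

lemma arg_lt_arg_of_mul_lt {u v u' v' : ℝ} (hv : 0 < v) (hv' : 0 < v')
    (h : u' * v < u * v') : Complex.arg ⟨u, v⟩ < Complex.arg ⟨u', v'⟩ := by
  by_contra hc
  have hz : (⟨u, v⟩ : ℂ) ≠ 0 := fun e => hv.ne' (congrArg Complex.im e)
  have hz' : (⟨u', v'⟩ : ℂ) ≠ 0 := fun e => hv'.ne' (congrArg Complex.im e)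
  have h0 : 0 ≤ Complex.arg ⟨u', v'⟩ := Complex.arg_nonneg_iff.2 hv'.le
  have hs := Real.sin_nonneg_of_nonneg_of_le_pi (sub_nonneg.2 (not_lt.1 hc))
    (by linarith [Complex.arg_le_pi ⟨u, v⟩])
  rw [Real.sin_sub, Complex.sin_arg, Complex.sin_arg, Complex.cos_arg hz, Complex.cos_arg hz'] at hs
  have hn := norm_pos_iff.2 hz
  have hn' := norm_pos_iff.2 hz'
  have : v / ‖(⟨u, v⟩ : ℂ)‖ * (u' / ‖(⟨u', v'⟩ : ℂ)‖) - u / ‖(⟨u, v⟩ : ℂ)‖ *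
      (v' / ‖(⟨u', v'⟩ : ℂ)‖) = (u' * v - u * v') / (‖(⟨u, v⟩ : ℂ)‖ * ‖(⟨u', v'⟩ : ℂ)‖) := by
    field_simp
  rw [this] at hs
  exact absurd hs (not_le.2 (div_neg_of_neg_of_pos (by linarith) (mul_pos hn hn')))

/-- On a line in `V_k`, `k = c + 1`, that leaves `V_{k-1}` at the point `z`, the polar coordinates
do not decrease beyond the point `y`. -/
lemma not_polarLT_of_one_le {n : ℕ} {c : Fin n} {y z q : Fin n → ℝ} {l : ℝ} (hl : 1 ≤ l)
    (hy : InV (c.1 + 1) y) (hy0 : ∀ i ≤ c, 0 < y i) (hz : InV c.1 z) (hz0 : ∀ i < c, 0 < z i)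
    (hq : ∀ i, q i = (1 - l) * z i + l * y i) (hq0 : ∀ i, 0 ≤ q i) : ¬ PolarLT q y := by
  have hyn : ∀ i, 0 ≤ y i := fun i => by
    rcases le_or_gt i c with h | h
    · exact (hy0 i h).le
    · exact (hy i h).ge
  have hqV : InV (c.1 + 1) q := fun i hi => by
    rw [hq, hy i hi, hz i (by omega)]
    simp
  have hqc : q c = l * y c := by
    rw [hq, hz c le_rfl]
    ring
  rcases hl.eq_or_lt with rfl | hl1
  · have : q = y := funext fun i => by
      rw [hq]
      ring
    rw [this]
    exact PolarLT.irrefl y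
  have hyc := hy0 c le_rfl
  have hc : polar y c < polar q c := by
    by_cases h0 : c.1 = 0
    · rw [polar, if_pos h0, polar, if_pos h0]
      have e1 := tailNorm_eq_of_inV hy (hyn c)
      have e2 := tailNorm_eq_of_inV hqV (hq0 c)
      rw [h0] at e1 e2
      rw [e1, e2, hqc]
      nlinarith
    · rw [polar_of_ne_zero y h0, polar_of_ne_zero q h0, tailNorm_eq_of_inV hy (hyn c),
        tailNorm_eq_of_inV hqV (hq0 c), hqc]
      apply arg_lt_arg_of_mul_lt hyc (by nlinarith)
      have hz1 := hz0 ⟨c.1 - 1, by omega⟩ (Fin.lt_def.2 (by simp only; omega))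
      rw [hq]
      nlinarith [mul_pos hz1 hyc]
  rintro ⟨m, hm, hlt⟩
  rcases lt_trichotomy m c with h | rfl | h
  · exact hc.ne' (hm c h)
  · exact lt_asymm hc hlt
  · have hm0 : m.1 ≠ 0 := by omega
    rw [(polar_eq_zero_iff hyn hm0).2 fun i hi => hy i (by omega)] at hlt
    exact absurd hlt (not_lt.2 (polar_nonneg _ _))

/-! ### Points of the flag on the elements of the intersection lattice -/

lemma PolarSystem.pt_eq {n : ℕ} (S : PolarSystem n) (y : Fin n → ℝ) :
    S.pt y = S.origin + Fintype.linearCombination ℝ S.axis y := rfl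

lemma card_nonMin_le {n : ℕ} (x : Pt n) : (nonMin x).card ≤ n := by
  have h : nonMin x ⊆ Finset.univ.erase 0 := fun t ht => by
    obtain ⟨a, ha, -⟩ := mem_nonMin.1 ht
    exact Finset.mem_erase.2 ⟨((Fin.zero_le a).trans_lt ha).ne', Finset.mem_univ _⟩
  simpa using Finset.card_le_card h

lemma PolarSystem.Generic.exists_point {n : ℕ} {S : PolarSystem n} (hS : S.Generic) (x : Pt n) :
    ∃ y : Fin n → ℝ, (∀ i : Fin n, i.1 < (nonMin x).card → 0 < y i) ∧ InV (nonMin x).card y ∧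
      S.pt y ∈ flatThrough x ∧
      ∀ y', InV (nonMin x).card y' → S.pt y' ∈ flatThrough x → y' = y := by
  obtain ⟨y, h1, h2⟩ := hS.2 x
  rw [← codim_faceOf, codim, vectorSpan_faceOf]
  have h3 := (h2 y).2 rfl
  exact ⟨y, h1, h3.1, h3.2, fun y' h h' => (h2 y').1 ⟨h, h'⟩⟩

/-- By genericity the point of `V_k` on an element of codimension `k` of the intersection lattice
lies on no smaller element. -/
lemma PolarSystem.Generic.nonMin_pt {n : ℕ} {S : PolarSystem n} (hS : S.Generic) {x : Pt n}
    {y : Fin n → ℝ} (hV : InV (nonMin x).card y) (hy : S.pt y ∈ flatThrough x) :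
    nonMin (S.pt y) = nonMin x := by
  have hsub : nonMin x ⊆ nonMin (S.pt y) := fun t ht => by
    obtain ⟨a, ha, e⟩ := mem_nonMin.1 ht
    exact mem_nonMin.2 ⟨a, ha, hy _ _ e⟩
  by_contra hne
  have hlt := Finset.card_lt_card (lt_of_le_of_ne hsub (Ne.symm hne))
  obtain ⟨y', h0, -, -, h⟩ := hS.exists_point (S.pt y)
  have e := h y (fun i hi => hV i (hlt.le.trans hi)) (fun _ _ h => h)
  let i : Fin n := ⟨(nonMin x).card, hlt.trans_le (card_nonMin_le _)⟩
  have h1 := h0 i hlt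
  rw [← e, hV i le_rfl] at h1
  exact lt_irrefl _ h1

lemma PolarSystem.IsTableauSystem.sign_pt {n : ℕ} {S : PolarSystem n} (hS : S.IsTableauSystem)
    {x : Pt n} {y : Fin n → ℝ} (hV : InV (nonMin x).card y) (hy : S.pt y ∈ flatThrough x)
    {a t : Fin (n + 1)} (hat : a < t) (ht : t ∉ nonMin x) :
    (Even ((nonMin x).filter fun s => t < s).card → S.pt y a < S.pt y t) ∧
    (¬ Even ((nonMin x).filter fun s => t < s).card → S.pt y t < S.pt y a) := by
  have e := hS.generic.nonMin_pt hV hy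
  obtain ⟨c, hc⟩ := (hS.criticalFace_iff (nonMin x).card (faceOf (S.pt y))).1
    ⟨⟨_, rfl⟩, by rw [codim_faceOf, e], y, hV, mem_faceOf_self _⟩
  rw [← e]
  exact hc.lt_iff_even (by rw [e]) hat (e ▸ ht)

/-! ### Critical cells -/

/-- The point `x` with its coordinates in `U` increased by one. If `U` is an upper set for the
order of a chamber, this splits every block into its parts inside and outside `U`. -/
noncomputable def raise {n : ℕ} (x : Pt n) (U : Set (Fin (n + 1))) : Pt n :=
  x + Set.indicator U 1

section Raise

variable {n : ℕ} {c x : Pt n} {U : Set (Fin (n + 1))}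

lemma raise_le (hx : ∀ s t, c s ≤ c t → x s ≤ x t) (hU : ∀ s t, c s ≤ c t → s ∈ U → t ∈ U)
    {s t : Fin (n + 1)} (h : c s ≤ c t) : raise x U s ≤ raise x U t := by
  refine add_le_add (hx s t h) ?_
  by_cases hs : s ∈ U
  · simp [hs, hU s t h hs]
  · by_cases ht : t ∈ U <;> simp [hs, ht]

lemma raise_lt (hx : ∀ s t, c s ≤ c t → x s ≤ x t) (hU : ∀ s t, c s ≤ c t → s ∈ U → t ∈ U)
    {s t : Fin (n + 1)} (h : x s < x t) : raise x U s < raise x U t := by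
  have hc : c s ≤ c t := (not_le.1 fun hc => absurd (hx t s hc) (not_le.2 h)).le
  refine add_lt_add_of_lt_of_le h ?_
  by_cases hs : s ∈ U
  · simp [hs, hU s t hc hs]
  · by_cases ht : t ∈ U <;> simp [hs, ht]

lemma raise_eq_iff (hx : ∀ s t, c s ≤ c t → x s ≤ x t) (hU : ∀ s t, c s ≤ c t → s ∈ U → t ∈ U)
    {s t : Fin (n + 1)} : raise x U s = raise x U t ↔ x s = x t ∧ (s ∈ U ↔ t ∈ U) := by
  constructor
  · intro h
    rcases lt_trichotomy (x s) (x t) with h1 | h1 | h1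
    · exact absurd h (raise_lt hx hU h1).ne
    · refine ⟨h1, ?_⟩
      simp only [raise, Pi.add_apply, h1, add_right_inj] at h
      by_cases hs : s ∈ U <;> by_cases ht : t ∈ U <;> simp [hs, ht] at h ⊢
    · exact absurd h (raise_lt hx hU h1).ne'
  · rintro ⟨h1, h2⟩
    by_cases hs : s ∈ U
    · simp [raise, h1, hs, h2.1 hs]
    · simp [raise, h1, hs, mt h2.2 hs]

/-- If `U` separates `t` from the smaller elements of its block, then cutting the blocks along `U`
makes `t` the least element of its block, and every other element that was not least in its block
remains so. -/
lemma nonMin_raise (hx : ∀ s t, c s ≤ c t → x s ≤ x t) (hU : ∀ s t, c s ≤ c t → s ∈ U → t ∈ U)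
    {t : Fin (n + 1)} (ht : t ∈ nonMin x) (hUx : ∀ s, x s ≠ x t → ∀ u, x u = x s → (u ∈ U ↔ s ∈ U))
    (hUt : ∀ a < t, x a = x t → ¬ (a ∈ U ↔ t ∈ U)) :
    nonMin (raise x U) = (nonMin x).erase t := by
  ext s
  rw [Finset.mem_erase, mem_nonMin]
  simp only [raise_eq_iff hx hU]
  constructor
  · rintro ⟨a, has, e, hm⟩
    refine ⟨?_, mem_nonMin.2 ⟨a, has, e⟩⟩
    rintro rfl
    exact hUt a has e hm
  · rintro ⟨hst, hs⟩
    obtain ⟨a, has, e⟩ := mem_nonMin.1 hs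
    obtain ⟨b, hbt, e'⟩ := mem_nonMin.1 ht
    by_cases hxs : x s = x t
    · have hb := hUt b hbt e'
      by_cases hside : s ∈ U ↔ t ∈ U
      · have hts : t < s := lt_of_le_of_ne (not_lt.1 fun h => hUt s h hxs hside) (Ne.symm hst)
        exact ⟨t, hts, hxs.symm, hside.symm⟩
      · rcases lt_or_gt_of_ne hst with h | h
        · have := hUt a (has.trans h) (e.trans hxs)
          exact ⟨a, has, e, by tauto⟩
        · exact ⟨b, hbt.trans h, e'.trans hxs.symm, by tauto⟩
    · exact ⟨a, has, e, hUx s hxs a e⟩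

end Raise

/-- Let `G` be the face obtained by cutting the block of `t` along `U`. Its flat meets `V_k` in a
line through the point `y` of `p`, along which the polar order increases away from the point `z` in
`V_{k-1}`. On a critical cell `G` precedes `p`, so its closure meets the side of `y` where `z` lies,
and there `x_t - x_a`, which vanishes at `y`, has the same sign as at `z`. At `z` this sign is known
from the tableau. -/
lemma even_iff_mem_of_critical {n : ℕ} {S : PolarSystem n} (hS : S.IsTableauSystem) {c x : Pt n}
    (hx : ∀ s t, c s ≤ c t → x s ≤ x t) {y : Fin n → ℝ}
    (hy : S.MeetsAt (nonMin x).card (faceOf x) y)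
    (hcrit : ∀ G, IsFace G → FaceLE (faceOf c) G → FaceLE G (faceOf x) → G ≠ faceOf x →
      ∃ q : Fin n → ℝ, (∀ i, 0 ≤ q i) ∧ S.pt q ∈ closure G ∧ PolarLT q y)
    {U : Set (Fin (n + 1))} (hU : ∀ s t, c s ≤ c t → s ∈ U → t ∈ U) {t : Fin (n + 1)}
    (ht : t ∈ nonMin x) (hUx : ∀ s, x s ≠ x t → ∀ u, x u = x s → (u ∈ U ↔ s ∈ U))
    (hUt : ∀ a < t, x a = x t → ¬ (a ∈ U ↔ t ∈ U)) :
    Even ((nonMin x).filter fun s => t < s).card ↔ t ∈ U := by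
  have hnm := nonMin_raise hx hU ht hUx hUt
  set g := raise x U with hg
  have hcard : (nonMin g).card + 1 = (nonMin x).card := by
    rw [hnm, Finset.card_erase_add_one ht]
  have hfilter : ((nonMin g).filter fun s => t < s) = (nonMin x).filter fun s => t < s := by
    ext s
    simp only [hnm, Finset.mem_filter, Finset.mem_erase]
    exact ⟨fun h => ⟨h.1.2, h.2⟩, fun h => ⟨⟨h.2.ne', h.1⟩, h.2⟩⟩
  have htg : t ∉ nonMin g := by simp [hnm]
  obtain ⟨q, hq0, hqG, hlt⟩ := hcrit (faceOf g) ⟨g, rfl⟩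
    (faceLE_faceOf.2 fun s t h => raise_le hx hU h)
    (faceLE_faceOf.2 fun s t h => not_lt.1 fun h' => absurd (raise_lt hx hU h') (not_lt.2 h))
    (fun e => by
      have := codim_faceOf g
      rw [e, codim_faceOf x] at this
      omega)
  rw [closure_faceOf] at hqG
  have hqf : S.pt q ∈ flatThrough g := fun a b e => le_antisymm (hqG a b e.le) (hqG b a e.ge)
  have hxy : ∀ a b, x a = x b → S.pt y a = S.pt y b := fun a b =>
    (eq_iff_of_mem_faceOf hy.2 a b).2
  have hyf : S.pt y ∈ flatThrough g := fun a b e => hxy a b ((raise_eq_iff hx hU).1 e).1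
  obtain ⟨y', hy0, -, -, hyu⟩ := hS.generic.exists_point x
  obtain rfl := hyu y hy.1 hxy
  obtain ⟨z, hz0, hzV, hzf, hzu⟩ := hS.generic.exists_point g
  let k : Fin n := ⟨(nonMin g).card, by have := card_nonMin_le x; omega⟩
  have hyV : InV (k.1 + 1) y := by
    have := hy.1
    rwa [← hcard] at this
  have hyk : 0 < y k := hy0 k (by simp only [k]; omega)
  have hyn : ∀ i, 0 ≤ y i := fun i => by
    rcases lt_or_ge i.1 (nonMin x).card with h | h
    · exact (hy0 i h).le
    · exact (hy.1 i h).ge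
  have hqV : InV (k.1 + 1) q := hlt.inV (Nat.succ_ne_zero _) hq0 hyn hyV
  -- The flat of `g` meets `V_k` in a line, on which the `k`-th coordinate is a parameter.
  obtain ⟨l, hl⟩ : ∃ l, l = q k / y k := ⟨_, rfl⟩
  have hqk : q k = l * y k := by rw [hl, div_mul_cancel₀ _ hyk.ne']
  have hqe : z + (q - ((1 - l) • z + l • y)) = z := by
    apply hzu
    · intro i hi
      have hzi := hzV i hi
      rcases (show k.1 ≤ i.1 from hi).eq_or_lt with h | h
      · obtain rfl : k = i := Fin.ext h
        simp only [Pi.add_apply, Pi.sub_apply, Pi.smul_apply, smul_eq_mul, hzi, hqk]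
        ring
      · simp [hzi, hqV i h, hyV i h]
    · have e : S.pt (z + (q - ((1 - l) • z + l • y))) =
          S.pt z + (S.pt q - ((1 - l) • S.pt z + l • S.pt y)) := by
        simp only [S.pt_eq, map_add, map_sub, map_smul]
        module
      rw [e]
      exact add_mem hzf (sub_mem hqf (add_mem (Submodule.smul_mem _ _ hzf)
        (Submodule.smul_mem _ _ hyf)))
  have hqe' : q = (1 - l) • z + l • y := sub_eq_zero.1 (add_eq_left.1 hqe)
  have hpt : S.pt q = (1 - l) • S.pt z + l • S.pt y := by
    rw [hqe']
    simp only [S.pt_eq, map_add, map_smul]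
    module
  have hl1 : l < 1 := by
    by_contra hcon
    refine not_polarLT_of_one_le (not_lt.1 hcon) hyV (fun i hi => hy0 i ?_) hzV
      (fun i hi => hz0 i hi) (fun i => by rw [hqe']; rfl) hq0 hlt
    have : i.1 ≤ (nonMin g).card := hi
    omega
  obtain ⟨a, hat, e⟩ := mem_nonMin.1 ht
  have hsign := hS.sign_pt hzV hzf hat htg
  rw [hfilter] at hsign
  have hye := hxy a t e
  have hqa := congrFun hpt a
  have hqt := congrFun hpt t
  simp only [Pi.add_apply, Pi.smul_apply, smul_eq_mul] at hqa hqt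
  have hmem := hUt a hat e
  by_cases htU : t ∈ U
  · simp only [htU, iff_true] at hmem ⊢
    by_contra hev
    have hca : c a ≤ c t := (not_le.1 fun h => hmem (hU t a h htU)).le
    have h1 := hqG a t (raise_le hx hU hca)
    have h2 := hsign.2 hev
    rw [hqa, hqt, hye] at h1
    nlinarith
  · simp only [htU, iff_false, not_not] at hmem ⊢
    intro hev
    have hca : c t ≤ c a := (not_le.1 fun h => htU (hU a t h hmem)).le
    have h1 := hqG t a (raise_le hx hU hca)
    have h2 := hsign.1 hev
    rw [hqa, hqt, hye] at h1
    nlinarith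

/-! ### The correspondence -/

/-- The criticality condition on the order of the chamber inside the block of `t`. It ensures that
the hyperplane with larger index `t` can be chosen: otherwise all smaller elements of the block lie
on the wrong side of `t`, and cutting the block at `t` gives a face that does not precede `p`. -/
lemma exists_of_critical {n : ℕ} {S : PolarSystem n} (hS : S.IsTableauSystem) {c x : Pt n}
    (hc : Function.Injective c) (hcell : S.IsCriticalCell (nonMin x).card (faceOf c) (faceOf x))
    {t : Fin (n + 1)} (ht : t ∈ nonMin x) :
    (Even ((nonMin x).filter fun s => t < s).card → ∃ a < t, x a = x t ∧ c a < c t) ∧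
    (¬ Even ((nonMin x).filter fun s => t < s).card → ∃ a < t, x a = x t ∧ c t < c a) := by
  obtain ⟨-, hle, ⟨-, -, y, hy⟩, hcrit⟩ := hcell
  have hx := faceLE_faceOf.1 hle
  have key := fun U => even_iff_mem_of_critical hS hx hy (hcrit y hy) (U := U) (ht := ht)
  have hlt : ∀ s u, x s < x u → c s < c u := fun s u h =>
    not_le.1 fun h' => absurd (hx _ _ h') (not_le.2 h)
  constructor
  · intro hev
    by_contra! hcon
    have hca : ∀ a < t, x a = x t → c t < c a := fun a ha e =>
      lt_of_le_of_ne (hcon a ha e) fun e' => ha.ne' (hc e')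
    -- If `t` comes first, cut just after it; it then lies below the cut.
    have := (key {a | c t < c a} (fun s u h hs => lt_of_lt_of_le hs h) ?_ ?_).1 hev
    · exact lt_irrefl (c t) this
    · intro s hs u e
      rcases lt_or_gt_of_ne hs with h | h
      · exact iff_of_false (hlt u t (e ▸ h)).not_gt (hlt s t h).not_gt
      · exact iff_of_true (hlt t u (e ▸ h)) (hlt t s h)
    · intro a ha e h
      exact lt_irrefl (c t) (h.1 (hca a ha e))
  · intro hev
    by_contra! hcon
    have hca : ∀ a < t, x a = x t → c a < c t := fun a ha e =>
      lt_of_le_of_ne (hcon a ha e) fun e' => ha.ne (hc e')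
    -- If `t` comes last, cut just before it; it then lies above the cut.
    refine hev ((key {a | c t ≤ c a} (fun s u h hs => le_trans hs h) ?_ ?_).2 (le_refl (c t)))
    · intro s hs u e
      rcases lt_or_gt_of_ne hs with h | h
      · exact iff_of_false (hlt u t (e ▸ h)).not_ge (hlt s t h).not_ge
      · exact iff_of_true (hlt t u (e ▸ h)).le (hlt t s h).le
    · intro a ha e h
      exact (hca a ha e).not_ge (h.2 (le_refl (c t)))

/-- `s` is the smaller index of the hyperplane of the tuple with larger index `t`: the element of
the block of `t` below `t` which is the last one before `t`, or the first one after `t`, in the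
order of the coordinates of `c`, if the number of larger elements that are not least in
their block is even, respectively odd. -/
def IsPartner {n : ℕ} (c x : Pt n) (t s : Fin (n + 1)) : Prop :=
  s < t ∧ x s = x t ∧
  (Even ((nonMin x).filter fun u => t < u).card → c s < c t ∧
    ∀ a < t, x a = x t → c a < c t → a ≠ s → c a < c s) ∧
  (¬ Even ((nonMin x).filter fun u => t < u).card → c t < c s ∧
    ∀ a < t, x a = x t → c t < c a → a ≠ s → c s < c a)

lemma IsPartner.unique {n : ℕ} {c x : Pt n} {t s s' : Fin (n + 1)} (h : IsPartner c x t s)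
    (h' : IsPartner c x t s') : s = s' := by
  by_contra hne
  obtain ⟨h1, h2, h3, h4⟩ := h
  obtain ⟨h1', h2', h3', h4'⟩ := h'
  by_cases hev : Even ((nonMin x).filter fun u => t < u).card
  · exact lt_asymm ((h3 hev).2 s' h1' h2' (h3' hev).1 (Ne.symm hne))
      ((h3' hev).2 s h1 h2 (h3 hev).1 hne)
  · exact lt_asymm ((h4 hev).2 s' h1' h2' (h4' hev).1 (Ne.symm hne))
      ((h4' hev).2 s h1 h2 (h4 hev).1 hne)

lemma exists_isPartner {n : ℕ} {S : PolarSystem n} (hS : S.IsTableauSystem) {c x : Pt n}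
    (hc : Function.Injective c) (hcell : S.IsCriticalCell (nonMin x).card (faceOf c) (faceOf x))
    {t : Fin (n + 1)} (ht : t ∈ nonMin x) : ∃ s, IsPartner c x t s := by
  classical
  obtain ⟨he, ho⟩ := exists_of_critical hS hc hcell ht
  by_cases hev : Even ((nonMin x).filter fun u => t < u).card
  · obtain ⟨a, h1, h2, h3⟩ := he hev
    obtain ⟨s, hs, hmax⟩ := Finset.exists_max_image
      (Finset.univ.filter fun a => a < t ∧ x a = x t ∧ c a < c t) c ⟨a, by simp [h1, h2, h3]⟩
    simp only [Finset.mem_filter, Finset.mem_univ, true_and, and_imp] at hs hmax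
    exact ⟨s, hs.1, hs.2.1, fun _ => ⟨hs.2.2, fun b hb e hlt hne =>
      lt_of_le_of_ne (hmax b hb e hlt) fun e => hne (hc e)⟩, fun h => absurd hev h⟩
  · obtain ⟨a, h1, h2, h3⟩ := ho hev
    obtain ⟨s, hs, hmin⟩ := Finset.exists_min_image
      (Finset.univ.filter fun a => a < t ∧ x a = x t ∧ c t < c a) c ⟨a, by simp [h1, h2, h3]⟩
    simp only [Finset.mem_filter, Finset.mem_univ, true_and, and_imp] at hs hmin
    exact ⟨s, hs.1, hs.2.1, fun h => absurd h hev, fun _ => ⟨hs.2.2, fun b hb e hlt hne =>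
      lt_of_le_of_ne (hmin b hb e hlt) fun e => hne (hc e).symm⟩⟩

lemma card_filter_lt_orderEmbOfFin {n : ℕ} {A : Finset (Fin (n + 1))} {k : ℕ} (hA : A.card = k)
    (j : Fin k) : (A.filter fun u => A.orderEmbOfFin hA j < u).card = k - (j.1 + 1) := by
  have : (A.filter fun u => A.orderEmbOfFin hA j < u) =
      (Finset.Ioi j).map (A.orderEmbOfFin hA).toEmbedding := by
    ext u
    simp only [Finset.mem_filter, Finset.mem_map, Finset.mem_Ioi]
    constructor
    · rintro ⟨hu, hlt⟩
      have : u ∈ Set.range (A.orderEmbOfFin hA) := by rwa [Finset.range_orderEmbOfFin]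
      obtain ⟨i, rfl⟩ := this
      exact ⟨i, (A.orderEmbOfFin hA).lt_iff_lt.1 hlt, rfl⟩
    · rintro ⟨i, hi, rfl⟩
      exact ⟨Finset.orderEmbOfFin_mem A hA i, (A.orderEmbOfFin hA).lt_iff_lt.2 hi⟩
  rw [this, Finset.card_map, Fin.card_Ioi]
  omega

lemma NablaRel.apply_eq {n k : ℕ} {c x : Pt n} {H : Fin k → HPair n}
    (h : NablaRel (faceOf c) (faceOf x) H) (j : Fin k) : x (H j).1 = x (H j).2 := by
  have hx : x ∈ ⋂ j, hyp (H j) := by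
    rw [h.support, affineSpan_faceOf]
    exact fun _ _ e => e
  exact Set.mem_iInter.1 hx j

/-- The larger indices of the tuple are the elements that are not the least of their block. -/
lemma NablaRel.snd_eq {n k : ℕ} {c x : Pt n} (hk : (nonMin x).card = k) {H : Fin k → HPair n}
    (h : NablaRel (faceOf c) (faceOf x) H) :
    (fun j => (H j).2) = (nonMin x).orderEmbOfFin hk :=
  Finset.orderEmbOfFin_unique hk (fun j => mem_nonMin.2 ⟨_, h.nbc.1 j, h.apply_eq j⟩) h.nbc.2

lemma NablaRel.exists_snd_eq {n k : ℕ} {c x : Pt n} (hk : (nonMin x).card = k)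
    {H : Fin k → HPair n} (h : NablaRel (faceOf c) (faceOf x) H) (a b : Fin (n + 1)) (hab : a < b)
    (e : x a = x b) : ∃ j, (H j).2 = b := by
  have hb : b ∈ Set.range ((nonMin x).orderEmbOfFin hk) := by
    rw [Finset.range_orderEmbOfFin]
    exact mem_nonMin.2 ⟨a, hab, e⟩
  rwa [← h.snd_eq hk] at hb

lemma neg_one_pow_sub_iff {n k : ℕ} {x : Pt n} (hk : (nonMin x).card = k) {t : Fin (n + 1)}
    {j : Fin k} (ht : t = (nonMin x).orderEmbOfFin hk j) :
    ((-1 : ℤ) ^ (k - (j.1 + 1)) = 1 ↔ Even ((nonMin x).filter fun u => t < u).card) ∧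
    ((-1 : ℤ) ^ (k - (j.1 + 1)) = -1 ↔ ¬ Even ((nonMin x).filter fun u => t < u).card) := by
  rw [ht, card_filter_lt_orderEmbOfFin hk j, neg_one_pow_eq_one_iff_even (by decide),
    neg_one_pow_eq_neg_one_iff_odd (by decide), Nat.not_even_iff_odd]
  exact ⟨Iff.rfl, Iff.rfl⟩

lemma NablaRel.isPartner {n k : ℕ} {c x : Pt n} (hk : (nonMin x).card = k) {H : Fin k → HPair n}
    (hc : Function.Injective c) (h : NablaRel (faceOf c) (faceOf x) H) (j : Fin k) :
    IsPartner c x (H j).2 (H j).1 := by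
  obtain ⟨h1, h2⟩ := neg_one_pow_sub_iff hk (congrFun (h.snd_eq hk) j)
  have hlt := h.nbc.1 j
  have hx := h.apply_eq j
  have hcls : ∀ a < (H j).2, x a = x (H j).2 → (a, (H j).2) ∈ hypClass (faceOf x) (H j) :=
    fun a ha e => ⟨ha, rfl, subset_hyp_iff.2 e⟩
  refine ⟨hlt, hx, fun hev => ?_, fun hev => ?_⟩
  · obtain ⟨h3, h4⟩ := h.even j (h1.2 hev)
    rw [separates_iff hlt, not_lt] at h3
    refine ⟨lt_of_le_of_ne h3 fun e => hlt.ne (hc e), fun a ha e hca hne => ?_⟩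
    refine hypBefore_iff.1 (h4 _ (hcls a ha e) ?_ fun e' => hne (congrArg Prod.fst e'))
    rw [separates_iff ha]
    exact hca.not_gt
  · obtain ⟨h3, h4⟩ := h.odd j (h2.2 hev)
    rw [separates_iff hlt] at h3
    refine ⟨h3, fun a ha e hca hne => ?_⟩
    exact hypBefore_iff.1 (h4 _ (hcls a ha e) ((separates_iff ha).2 hca)
      fun e' => hne (congrArg Prod.fst e'))

/-- The tuple made of the partners has all the properties required of the correspondence; the last
hyperplane is a wall because the last `t` is the largest element of its block. -/
lemma nablaRel_of_isPartner {n k : ℕ} {c x : Pt n} (hk : (nonMin x).card = k)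
    (hc : Function.Injective c) (hx : ∀ s t, c s ≤ c t → x s ≤ x t) {H : Fin k → HPair n}
    (h2 : ∀ j, (H j).2 = (nonMin x).orderEmbOfFin hk j)
    (h1 : ∀ j, IsPartner c x (H j).2 (H j).1) : NablaRel (faceOf c) (faceOf x) H where
  nbc := ⟨fun j => (h1 j).1, fun i j hij => by
    simp only [h2]
    exact ((nonMin x).orderEmbOfFin hk).lt_iff_lt.2 hij⟩
  support := by
    rw [affineSpan_faceOf]
    ext z
    simp only [Set.mem_iInter, SetLike.mem_coe, mem_flatThrough]
    refine ⟨fun hz => ?_, fun hz j => hz _ _ (h1 j).2.1⟩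
    have key : ∀ b, ∀ a < b, x a = x b → z a = z b := by
      intro b
      induction b using WellFoundedLT.induction with
      | _ b ih =>
        intro a hab e
        have hb : b ∈ Set.range ((nonMin x).orderEmbOfFin hk) := by
          rw [Finset.range_orderEmbOfFin]
          exact mem_nonMin.2 ⟨a, hab, e⟩
        obtain ⟨j, rfl⟩ := hb
        have hj : z (H j).1 = z (H j).2 := hz j
        obtain ⟨hl, hxj, -⟩ := h1 j
        rw [h2 j] at hl hxj hj
        rw [← hj]
        rcases lt_trichotomy a (H j).1 with h | h | h
        · exact ih _ hl a h (e.trans hxj.symm)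
        · rw [h]
        · exact (ih a hab _ h (hxj.trans e.symm)).symm
    intro s t e
    rcases lt_trichotomy s t with h | h | h
    · exact key t s h e
    · rw [h]
    · exact (key s t h e.symm).symm
  odd := fun j hj => by
    obtain ⟨hl, hxj, -, ho⟩ := h1 j
    obtain ⟨h3, h4⟩ := ho ((neg_one_pow_sub_iff hk (h2 j)).2.1 hj)
    refine ⟨(separates_iff hl).2 h3, ?_⟩
    rintro ⟨a, b⟩ ⟨hab, rfl : b = _, hs⟩ hsep hne
    exact hypBefore_iff.2 (h4 a hab (subset_hyp_iff.1 hs) ((separates_iff hab).1 hsep)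
      fun e => hne (Prod.ext e rfl))
  even := fun j hj => by
    obtain ⟨hl, hxj, he, -⟩ := h1 j
    obtain ⟨h3, h4⟩ := he ((neg_one_pow_sub_iff hk (h2 j)).1.1 hj)
    refine ⟨fun h => h3.not_gt ((separates_iff hl).1 h), ?_⟩
    rintro ⟨a, b⟩ ⟨hab, rfl : b = _, hs⟩ hsep hne
    refine hypBefore_iff.2 (h4 a hab (subset_hyp_iff.1 hs) ?_ fun e => hne (Prod.ext e rfl))
    exact lt_of_le_of_ne (not_lt.1 fun h => hsep ((separates_iff hab).2 h))
      fun e => hab.ne (hc e)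
  wall := fun j hj => by
    obtain ⟨hl, hxj, he, -⟩ := h1 j
    obtain ⟨h3, h4⟩ := he ((neg_one_pow_sub_iff hk (h2 j)).1.1 (by rw [hj]; simp))
    refine ⟨isWall_of_adjacent hc hl h3 fun u hu hu' => ?_,
      fun h => h3.not_gt ((separates_iff hl).1 h)⟩
    have hxu : x u = x (H j).2 :=
      le_antisymm (hx _ _ hu'.le) (hxj ▸ hx _ _ hu.le)
    rcases lt_trichotomy u (H j).2 with h | h | h
    · exact lt_asymm hu (h4 u h hxu hu' fun e => lt_irrefl _ (e ▸ hu))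
    · exact lt_irrefl _ (h ▸ hu')
    · have hur : u ∈ Set.range ((nonMin x).orderEmbOfFin hk) := by
        rw [Finset.range_orderEmbOfFin]
        exact mem_nonMin.2 ⟨_, h, hxu.symm⟩
      obtain ⟨i, rfl⟩ := hur
      rw [h2 j, OrderEmbedding.lt_iff_lt, Fin.lt_def] at h
      omega

/-- The order of a tuple in the correspondence is total on the rows of a tableau of `p`. -/
lemma NablaRel.isStrictTotalOrder {n k : ℕ} {c x : Pt n} (hk : (nonMin x).card = k)
    {H : Fin k → HPair n} (h : NablaRel (faceOf c) (faceOf x) H) {A : Set (Fin (n + 1))}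
    (hA : ∀ a ∈ A, ∀ b ∈ A, x a = x b) :
    IsStrictTotalOrder {a // a ∈ A} (fun a b => cellLT k H a.1 b.1) := by
  obtain ⟨-, h2, h3, h4⟩ := cellLT_order h.nbc x h.apply_eq (h.exists_snd_eq hk)
  exact
    { trichotomous := fun a b hab hba => Subtype.ext
        (((h4 a b (hA a a.2 b b.2)).resolve_left hab).resolve_right hba)
      irrefl := fun a => h2 a
      trans := fun a b c => h3 a b c }

end Braid

theorem mainTheorem9 (n : ℕ) (S : Braid.PolarSystem n) (hS : S.IsTableauSystem)
    (k : ℕ) (C p : Set (Braid.Pt n)) (hCp : S.IsCriticalCell k C p) :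
    (∃! H : Fin k → Braid.HPair n, Braid.NablaRel C p H) ∧
    ∀ H : Fin k → Braid.HPair n, Braid.NablaRel C p H →
      (∀ j : Fin k, (-1 : ℤ) ^ (k - (j.1 + 1)) = 1 → Braid.cellLT k H (H j).2 (H j).1) ∧
      (∀ j : Fin k, (-1 : ℤ) ^ (k - (j.1 + 1)) = -1 → Braid.cellLT k H (H j).1 (H j).2) ∧
      (∀ j : Fin k, j.1 + 1 = k →
        ¬ ∃ c, Braid.cellLT k H (H j).2 c ∧ Braid.cellLT k H c (H j).1) ∧
      ∀ T : Braid.Tab n, Braid.Represents T p →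
        T.length + k = n + 1 ∧
        ∀ i : Fin T.length,
          IsStrictTotalOrder {a // a ∈ T[i]} (fun a b => Braid.cellLT k H a.1 b.1) := by
  obtain ⟨c, hc, rfl⟩ := hCp.1
  obtain ⟨x, rfl⟩ := hCp.2.2.1.1
  have hk : (Braid.nonMin x).card = k := (Braid.codim_faceOf x).symm.trans hCp.2.2.1.2.1
  constructor
  · choose s hs using fun j : Fin k => Braid.exists_isPartner hS hc (by rwa [hk])
      (Finset.orderEmbOfFin_mem (Braid.nonMin x) hk j)
    refine ⟨fun j => (s j, (Braid.nonMin x).orderEmbOfFin hk j),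
      Braid.nablaRel_of_isPartner hk hc (Braid.faceLE_faceOf.1 hCp.2.1) (fun _ => rfl) hs, ?_⟩
    intro H hH
    funext j
    have h2 := congrFun (hH.snd_eq hk) j
    have h1 := hH.isPartner hk hc j
    change (H j).2 = _ at h2
    rw [h2] at h1
    exact Prod.ext (h1.unique (hs j)) h2
  · intro H hH
    refine ⟨fun j => (Braid.cellLT_pair hH.nbc j).1, fun j => (Braid.cellLT_pair hH.nbc j).2,
      ?_, fun T hT => ⟨hk ▸ hT.length_add_card, fun i => ?_⟩⟩
    · rintro j hj ⟨b, h1, h2⟩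
      obtain ⟨m, rfl⟩ : ∃ m, k = m + 1 := ⟨j.1, hj.symm⟩
      obtain rfl : j = Fin.last m := Fin.ext (Nat.succ_injective hj)
      exact Braid.cellLT_adjacent hH.nbc x hH.apply_eq (hH.exists_snd_eq hk) b h1 h2
    · refine hH.isStrictTotalOrder hk (A := {a | a ∈ T[i]}) fun a ha b hb => ?_
      have hrow : ∀ a ∈ T[i], Braid.rowOf T a = i.1 := fun a ha =>
        hT.1.rowOf_eq (List.getElem?_eq_getElem i.2) ha
      exact (((hT.2 x).1 (Braid.mem_faceOf_self x) a b).1).2 ((hrow a ha).trans (hrow b hb).symm)
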